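/- Let $M$ be a smooth Hausdorff 3-manifold without boundary and let $\mathscr B\subset M$ be a branched surface whose fibres are oriented. This means the following. A direction field $X$ is given on $M$ whose oriented integral curves are the fibres. Near each of its points, in a smooth chart $(x,y,z)$ in which the oriented fibres are the upward vertical lines, $\mathscr B$ is one of: (1) the sheet $z=0$; (2) the union of the smooth sheets $z=0$ and $z=b(x,y)\ge 0$, where $b>0$ exactly for $x>0$; (3) the union of the smooth sheets $z=-a(x,y)\le 0$, $z=0$ and $z=b(x,y)\ge 0$, where $a>0$ exactly for $x>0$ and $b>0$ exactly for $y>0$. The singular locus of $\mathscr B$ is $\{x=z=0\}$ in (2) and $\{z=0,\ xy=0\}$ in (3). In (3) the centre is a double point, at which the smooth branch $\{y=z=0\}$ of the singular locus is over the smooth branch $\{x=z=0\}$. The branch direction at a branch point that is not a double point points towards the single sheet. A positive (resp. negative) twisted curve of $\mathscr B$ is an immersed oriented closed curve in the singular locus, made of finitely many consecutive segments that go straight through the double points, with at least one corner, such that at every corner (a double point) the curve passes from the lower smooth branch to the upper one (resp. from the upper to the lower). An arc of splitting in face-to-face position is a smoothly embedded arc $\gamma:[0,1]\to\mathscr B$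 whose interior lies in the regular part of $\mathscr B$ (hence in one sector) and whose ends $\gamma(0),\gamma(1)$ are branch points, not double points, at which $\gamma$ is transverse to the singular locus and the branch direction points into the sector. Splittings along $\gamma$ change $\mathscr B$ only in a compact part of a chart with vertical oriented fibres around $\gamma$, in which $\gamma=\{x=z=0,\ |y|\le 1\}$, $\gamma(0)$ has $y=-1$, $\gamma(1)$ has $y=1$, and $\mathscr B$ consists of two sheets that coincide exactly for $|y|\le 1$. The result is again a branched surface with the same oriented fibres. In the over (resp. under) splitting the branching $y=-1$ is pushed along $\gamma$ over (resp. under) the branching $y=1$, so that the two cross in exactly two double points. In the neutral splitting the sector is cut open along $\gamma$, so that the two branchings are replaced by two curves, one on each side of $\gamma$, each joining a half of the former to a half of the latter. Suppose that $\mathscr B$ has no twisted curve and let $\gamma$ be an arc of splitting in face-to-face position in $\mathscr B$. Let $\mathscr B_{\rm over}$, $\mathscr B_{\rm under}$, $\mathscr B_{\rm neutral}$ be obtained from $\mathscr B$ by an over, an under and a neutral splitting along $\gamma$. Then at least one of these three splittings is adapted, i.e. at least one of $\mathscr B_{\rm over}$, $\mathscr B_{\rm under}$, $\mathscr B_{\rm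 neutral}$ has no twisted curve. -/

import Mathlib

open Set Filter Topology
open scoped Manifold ContDiff

namespace BranchedSurface

/-- Three-dimensional coordinate space; the coordinates are `u 0, u 1, u 2` (`x, y, z`). -/
abbrev E3 : Type := EuclideanSpace ℝ (Fin 3)

section Definitions

variable {M : Type*} [TopologicalSpace M] [ChartedSpace E3 M]

/-- A smooth chart of `M` in which the oriented fibres (the oriented integral curves of the
direction field `X`) are the vertical segments, oriented upwards. -/
def IsFlowBox (X : ∀ p : M, TangentSpace (𝓡 3) p) (φ : OpenPartialHomeomorph M E3) : Prop :=
  φ ∈ IsManifold.maximalAtlas (𝓡 3) ∞ M ∧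
    ∀ q ∈ φ.source, ∃ r : ℝ, 0 < r ∧
      (mfderiv (𝓡 3) (𝓡 3) φ q (X q) : E3) = r • (EuclideanSpace.single 2 1 : E3)

/-- A flow box centred at `p`. -/
def IsFlowBoxAt (X : ∀ p : M, TangentSpace (𝓡 3) p) (p : M)
    (φ : OpenPartialHomeomorph M E3) : Prop :=
  IsFlowBox X φ ∧ p ∈ φ.source ∧ φ p = 0

/-- First local model: near `p` the set `B` is one smooth sheet transverse to the fibres. -/
def IsRegularModel (X : ∀ p : M, TangentSpace (𝓡 3) p) (B : Set M) (p : M)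
    (φ : OpenPartialHomeomorph M E3) : Prop :=
  IsFlowBoxAt X p φ ∧ ∀ᶠ q in 𝓝 p, (q ∈ B ↔ φ q 2 = 0)

/-- Second local model: near `p` the set `B` is the union of the smooth sheets `z = 0` and
`z = b(x, y)`, which coincide (hence are tangent) exactly where `x ≤ 0`.  The singular locus is
`x = z = 0`, and the branch direction is that of decreasing `x`, towards the single sheet. -/
def IsBranchModel (X : ∀ p : M, TangentSpace (𝓡 3) p) (B : Set M) (p : M)
    (φ : OpenPartialHomeomorph M E3) : Prop :=
  IsFlowBoxAt X p φ ∧ ∃ b : ℝ × ℝ → ℝ, ContDiff ℝ ∞ b ∧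
    (∀ᶠ u in 𝓝 (0 : ℝ × ℝ), 0 ≤ b u ∧ (0 < b u ↔ 0 < u.1)) ∧
    ∀ᶠ q in 𝓝 p, (q ∈ B ↔ φ q 2 = 0 ∨ φ q 2 = b (φ q 0, φ q 1))

/-- Third local model (double point): near `p` the set `B` is the union of the smooth sheets
`z = -a(x, y)`, `z = 0` and `z = b(x, y)`.  The lower two coincide exactly where `x ≤ 0`, the
upper two exactly where `y ≤ 0`.  The branching along `x = z = 0` is under the branching along
`y = z = 0`. -/
def IsDoubleModel (X : ∀ p : M, TangentSpace (𝓡 3) p) (B : Set M) (p : M)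
    (φ : OpenPartialHomeomorph M E3) : Prop :=
  IsFlowBoxAt X p φ ∧ ∃ a b : ℝ × ℝ → ℝ, ContDiff ℝ ∞ a ∧ ContDiff ℝ ∞ b ∧
    (∀ᶠ u in 𝓝 (0 : ℝ × ℝ), 0 ≤ a u ∧ (0 < a u ↔ 0 < u.1)) ∧
    (∀ᶠ u in 𝓝 (0 : ℝ × ℝ), 0 ≤ b u ∧ (0 < b u ↔ 0 < u.2)) ∧
    ∀ᶠ q in 𝓝 p, (q ∈ B ↔
      φ q 2 = -a (φ q 0, φ q 1) ∨ φ q 2 = 0 ∨ φ q 2 = b (φ q 0, φ q 1))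

/-- `B` is a branched surface in `M`, oriented by the direction field `X`: the fibres of its
fibred neighbourhood are the local integral curves of `X`, oriented by `X`. -/
def IsBranchedSurface (X : ∀ p : M, TangentSpace (𝓡 3) p) (B : Set M) : Prop :=
  ∀ p ∈ B, ∃ φ : OpenPartialHomeomorph M E3,
    IsRegularModel X B p φ ∨ IsBranchModel X B p φ ∨ IsDoubleModel X B p φ

/-- The curve `x = z = 0` of a chart: the singular locus in the second local model, the lower
smooth branch of the singular locus in the third one. -/
def lowerStrand (φ : OpenPartialHomeomorph M E3) : Set M :=
  {q | q ∈ φ.source ∧ φ q 0 = 0 ∧ φ q 2 = 0}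

/-- The curve `y = z = 0` of a chart: the upper smooth branch of the singular locus in the third
local model. -/
def upperStrand (φ : OpenPartialHomeomorph M E3) : Set M :=
  {q | q ∈ φ.source ∧ φ q 1 = 0 ∧ φ q 2 = 0}

/-- `c`, restricted to `[0, 1]`, is an immersed segment in the singular locus of `B` which is
smooth, i.e. which goes straight through every double point that it meets: near each parameter
it is injective and stays in one smooth branch of the singular locus. (The parametrization of
this smooth branch is only asked to be continuous.) -/
structure IsSmoothSegment (X : ∀ p : M, TangentSpace (𝓡 3) p) (B : Set M) (c : ℝ → M) :
    Prop where
  continuousOn : ContinuousOn c (Icc 0 1)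
  locallyInjective : ∀ t ∈ Icc (0 : ℝ) 1, ∃ s ∈ 𝓝[Icc 0 1] t, InjOn c s
  follows : ∀ t ∈ Icc (0 : ℝ) 1, ∃ φ : OpenPartialHomeomorph M E3,
    (IsBranchModel X B (c t) φ ∧ ∀ᶠ s in 𝓝[Icc 0 1] t, c s ∈ lowerStrand φ) ∨
    (IsDoubleModel X B (c t) φ ∧ ∀ᶠ s in 𝓝[Icc 0 1] t, c s ∈ lowerStrand φ) ∨
    (IsDoubleModel X B (c t) φ ∧ ∀ᶠ s in 𝓝[Icc 0 1] t, c s ∈ upperStrand φ)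

/-- The segment `c` ends, and the segment `c'` starts, at a common double point, where `c` lies in
the lower smooth branch of the singular locus and `c'` in the upper one. -/
def IsAscendingCorner (X : ∀ p : M, TangentSpace (𝓡 3) p) (B : Set M) (c c' : ℝ → M) : Prop :=
  c 1 = c' 0 ∧ ∃ φ : OpenPartialHomeomorph M E3, IsDoubleModel X B (c 1) φ ∧
    (∀ᶠ s in 𝓝[Icc 0 1] (1 : ℝ), c s ∈ lowerStrand φ) ∧
    (∀ᶠ s in 𝓝[Icc 0 1] (0 : ℝ), c' s ∈ upperStrand φ)

/-- The segment `c` ends, and the segment `c'` starts, at a common double point, where `c` lies in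
the upper smooth branch of the singular locus and `c'` in the lower one. -/
def IsDescendingCorner (X : ∀ p : M, TangentSpace (𝓡 3) p) (B : Set M) (c c' : ℝ → M) : Prop :=
  c 1 = c' 0 ∧ ∃ φ : OpenPartialHomeomorph M E3, IsDoubleModel X B (c 1) φ ∧
    (∀ᶠ s in 𝓝[Icc 0 1] (1 : ℝ), c s ∈ upperStrand φ) ∧
    (∀ᶠ s in 𝓝[Icc 0 1] (0 : ℝ), c' s ∈ lowerStrand φ)

/-- A positive twisted curve: a closed curve made of `n + 1 ≥ 1` consecutive smooth segments
`c 0, …, c n` of the singular locus (indices modulo `n + 1`), all corners being ascending. -/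
def IsPositiveTwistedCurve (X : ∀ p : M, TangentSpace (𝓡 3) p) (B : Set M) (n : ℕ)
    (c : Fin (n + 1) → ℝ → M) : Prop :=
  (∀ i, IsSmoothSegment X B (c i)) ∧ ∀ i, IsAscendingCorner X B (c i) (c (i + 1))

/-- A negative twisted curve: the same with all corners descending. -/
def IsNegativeTwistedCurve (X : ∀ p : M, TangentSpace (𝓡 3) p) (B : Set M) (n : ℕ)
    (c : Fin (n + 1) → ℝ → M) : Prop :=
  (∀ i, IsSmoothSegment X B (c i)) ∧ ∀ i, IsDescendingCorner X B (c i) (c (i + 1))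

/-- `B` has a (positive or negative) twisted curve. -/
def HasTwistedCurve (X : ∀ p : M, TangentSpace (𝓡 3) p) (B : Set M) : Prop :=
  ∃ (n : ℕ) (c : Fin (n + 1) → ℝ → M),
    IsPositiveTwistedCurve X B n c ∨ IsNegativeTwistedCurve X B n c

/-- `γ`, restricted to `[0, 1]`, is an arc of splitting in face-to-face position: a smoothly
embedded arc whose interior lies in the regular part of `B` (hence in the interior of one sector)
and whose two ends are branch points, not double points, at which the arc is transverse to the
singular locus and the branch direction points into the sector. -/
structure IsFaceToFaceArc (X : ∀ p : M, TangentSpace (𝓡 3) p) (B : Set M) (γ : ℝ → M) :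
    Prop where
  smooth : ContMDiffOn 𝓘(ℝ, ℝ) (𝓡 3) ∞ γ (Icc 0 1)
  immersed : ∀ t ∈ Icc (0 : ℝ) 1, mfderivWithin 𝓘(ℝ, ℝ) (𝓡 3) γ (Icc 0 1) t ≠ 0
  injective : InjOn γ (Icc 0 1)
  regular : ∀ t ∈ Ioo (0 : ℝ) 1, ∃ φ : OpenPartialHomeomorph M E3, IsRegularModel X B (γ t) φ
  start : ∃ φ : OpenPartialHomeomorph M E3, IsBranchModel X B (γ 0) φ ∧
    derivWithin (fun t => φ (γ t) 0) (Icc 0 1) 0 < 0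
  finish : ∃ φ : OpenPartialHomeomorph M E3, IsBranchModel X B (γ 1) φ ∧
    0 < derivWithin (fun t => φ (γ t) 0) (Icc 0 1) 1

/-- A flow box around the face-to-face arc `γ`, which is the segment `x = z = 0`, `-1 ≤ y ≤ 1`.
In it `B` is the union of the sheets `z = 0` and `z = h(x, y)`, which coincide exactly where
`-1 ≤ y ≤ 1`; the singular locus consists of `y = -1, z = 0` (through `γ 0`) and of
`y = 1, z = 0` (through `γ 1`), with branch directions pointing to each other. -/
structure IsSplittingBox (X : ∀ p : M, TangentSpace (𝓡 3) p) (B : Set M) (γ : ℝ → M)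
    (Φ : OpenPartialHomeomorph M E3) : Prop where
  flowBox : IsFlowBox X Φ
  target_eq : Φ.target = {u | ∀ i, |u i| < 3}
  arc : ∀ t ∈ Icc (0 : ℝ) 1, γ t ∈ Φ.source ∧
    Φ (γ t) 0 = 0 ∧ Φ (γ t) 1 = 2 * t - 1 ∧ Φ (γ t) 2 = 0
  sheets : ∃ h : ℝ × ℝ → ℝ, ContDiff ℝ ∞ h ∧
    (∀ x y : ℝ, |x| < 3 → |y| < 3 → 0 ≤ h (x, y) ∧ (0 < h (x, y) ↔ 1 < |y|)) ∧
    ∀ q ∈ Φ.source, (q ∈ B ↔ Φ q 2 = 0 ∨ Φ q 2 = h (Φ q 0, Φ q 1))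

/-- `B'` and `B` coincide outside the compact cube `|x|, |y|, |z| ≤ 2` of the chart `Φ`. -/
def AgreeOutside (Φ : OpenPartialHomeomorph M E3) (B B' : Set M) : Prop :=
  ∀ q : M, ¬ (q ∈ Φ.source ∧ ∀ i, |Φ q i| ≤ 2) → (q ∈ B' ↔ q ∈ B)

/-- In the chart `Φ` (with values in the cube of half-side 3), `B'` is the union of the graphs of
the smooth functions `f i`, increasing with `i`, whose part over `|x|, |y| ≤ 2` lies in the cube
of half-side 2. -/
structure IsStackOfSheets (Φ : OpenPartialHomeomorph M E3) (B' : Set M) {k : ℕ}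
    (f : Fin k → ℝ × ℝ → ℝ) : Prop where
  smooth : ∀ i, ContDiff ℝ ∞ (f i)
  ordered : ∀ i j, i ≤ j → ∀ x y : ℝ, |x| < 3 → |y| < 3 → f i (x, y) ≤ f j (x, y)
  bounded : ∀ i, ∀ x y : ℝ, |x| ≤ 2 → |y| ≤ 2 → |f i (x, y)| ≤ 2
  mem_iff : ∀ q ∈ Φ.source, (q ∈ B' ↔ ∃ i, Φ q 2 = f i (Φ q 0, Φ q 1))

/-- The new positions `y = s(x)` and `y = e(x)` of the branchings starting from `γ 0` and from
`γ 1` after they have been pushed along the arc past each other: they cross exactly twice. -/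
structure IsCrossingPair (s e : ℝ → ℝ) : Prop where
  smooth_s : ContDiff ℝ ∞ s
  smooth_e : ContDiff ℝ ∞ e
  range_s : ∀ x, -1 ≤ s x ∧ s x < 2
  range_e : ∀ x, -2 < e x ∧ e x ≤ 1
  unchanged : ∀ x, 2 ≤ |x| → s x = -1 ∧ e x = 1
  cross : ∃ r : ℝ, 0 < r ∧ r < 2 ∧
    ∀ x, (|x| < r → e x < s x) ∧ (|x| = r → s x = e x) ∧ (r < |x| → s x < e x)

/-- `B'` is an over splitting of `B` along `γ`: the branching at `γ 0` is pushed along `γ` over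
the branching at `γ 1`.  The opening behind the former is then between the two upper sheets,
where `y < s(x)`, and the opening behind the latter between the two lower ones, where
`e(x) < y`. -/
def IsOverSplitting (X : ∀ p : M, TangentSpace (𝓡 3) p) (B : Set M) (γ : ℝ → M)
    (B' : Set M) : Prop :=
  IsBranchedSurface X B' ∧ ∃ Φ : OpenPartialHomeomorph M E3,
    IsSplittingBox X B γ Φ ∧ AgreeOutside Φ B B' ∧
    ∃ s e : ℝ → ℝ, IsCrossingPair s e ∧ ∃ f : Fin 3 → ℝ × ℝ → ℝ, IsStackOfSheets Φ B' f ∧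
      ∀ x y : ℝ, |x| < 3 → |y| < 3 →
        (f 1 (x, y) < f 2 (x, y) ↔ y < s x) ∧ (f 0 (x, y) < f 1 (x, y) ↔ e x < y)

/-- `B'` is an under splitting of `B` along `γ`: the branching at `γ 0` is pushed along `γ` under
the branching at `γ 1`. -/
def IsUnderSplitting (X : ∀ p : M, TangentSpace (𝓡 3) p) (B : Set M) (γ : ℝ → M)
    (B' : Set M) : Prop :=
  IsBranchedSurface X B' ∧ ∃ Φ : OpenPartialHomeomorph M E3,
    IsSplittingBox X B γ Φ ∧ AgreeOutside Φ B B' ∧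
    ∃ s e : ℝ → ℝ, IsCrossingPair s e ∧ ∃ f : Fin 3 → ℝ × ℝ → ℝ, IsStackOfSheets Φ B' f ∧
      ∀ x y : ℝ, |x| < 3 → |y| < 3 →
        (f 0 (x, y) < f 1 (x, y) ↔ y < s x) ∧ (f 1 (x, y) < f 2 (x, y) ↔ e x < y)

/-- The new singular locus after the neutral splitting has the equation `y ^ 2 = g(x)`: two
curves, one in `x < 0` and one in `x > 0`, each joining the branching at `γ 0` to the branching
at `γ 1`. -/
structure IsNeutralProfile (g : ℝ → ℝ) : Prop where
  smooth : ContDiff ℝ ∞ g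
  le_one : ∀ x, g x ≤ 1
  unchanged : ∀ x, 2 ≤ |x| → g x = 1
  sign : ∃ r : ℝ, 0 < r ∧ r < 2 ∧
    ∀ x, (|x| < r → g x < 0) ∧ (|x| = r → g x = 0) ∧ (r < |x| → 0 < g x)

/-- `B'` is a neutral splitting of `B` along `γ`: the sector is cut open along `γ`, so that the
openings at its two ends become a single one, between two sheets. -/
def IsNeutralSplitting (X : ∀ p : M, TangentSpace (𝓡 3) p) (B : Set M) (γ : ℝ → M)
    (B' : Set M) : Prop :=
  IsBranchedSurface X B' ∧ ∃ Φ : OpenPartialHomeomorph M E3,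
    IsSplittingBox X B γ Φ ∧ AgreeOutside Φ B B' ∧
    ∃ g : ℝ → ℝ, IsNeutralProfile g ∧ ∃ f : Fin 2 → ℝ × ℝ → ℝ, IsStackOfSheets Φ B' f ∧
      ∀ x y : ℝ, |x| < 3 → |y| < 3 → (f 0 (x, y) < f 1 (x, y) ↔ g x < y ^ 2)

end Definitions

end BranchedSurface

/-!
The singular locus of `B`, with its two branches separated at every double point, is a disjoint
union of smooth curves.  Say that the curve `y` is over the curve `x` if at some double point the
upper branch belongs to `y` and the lower one to `x` (`IsOver`).  A segment of a twisted curve stays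
in one smooth curve, and a corner passes from a curve to one that is over it (or under it), so a
twisted curve gives a cycle of the relation `IsOver`; conversely every cycle is traced by a twisted
curve.  Hence `B` has no twisted curve exactly if `IsOver` is acyclic.

Let `S` and `E` be the smooth curves through the two ends of the arc.  The over splitting keeps the
curves and adds only the relation that `S` is over `E`; it creates a cycle only if `E` is
reachable from `S`.  Likewise the under splitting creates a cycle only if `S` is reachable from
`E`.  If `S ≠ E`, both cannot occur, as `IsOver` is acyclic.  If `S = E`, the neutral splitting only
cuts and reglues this curve, without new double points, so that collapsing the new curves to `S`
maps its relation into that of `B`, and there is no cycle.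

Three points carry the proof.

* The order of points along a fibre does not depend on the flow box (`exists_below_iff`), so the
  number of sheets that meet near a point is intrinsic; this tells regular points, branch
  points and double points apart.  At a double point the halves of the strands that have another
  sheet above or below are intrinsic, and the other halves are so because the transition maps are
  differentiable and the strands transverse (`IsDoubleModel.eventually_strand`).
* Two points of the same smooth curve are joined by a locally injective segment.  It is built by
  adding short arcs; backtracking is avoided by cutting at the first point on the new arc
  (`IsArc.isJoined`).
* For the modified surfaces only the easy direction is needed: a colouring of the curves that
  increases at double points excludes twisted curves (`IsCurveColoring.not_hasTwistedCurve`).  The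
  colours are the curves of `B`; inside the box they are read off from the equations of the new
  branchings (`IsGapChart.not_hasTwistedCurve`).
-/

namespace BranchedSurface

/-! ### Fibres in flow boxes -/

section Fibres

variable {M : Type*} [TopologicalSpace M]

/-- The projection along the fibres of a flow box: the coordinates `(x, y)`. -/
def base (φ : OpenPartialHomeomorph M E3) (q : M) : ℝ × ℝ := (φ q 0, φ q 1)

/-- In the chart `φ`, the point `q` lies strictly below `q'` on the same vertical line. -/
def Below (φ : OpenPartialHomeomorph M E3) (q q' : M) : Prop :=
  base φ q = base φ q' ∧ φ q 2 < φ q' 2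

theorem Below.exists_eq {φ : OpenPartialHomeomorph M E3} {q q' : M} (h : Below φ q q') :
    φ q' = φ q + (φ q' 2 - φ q 2) • (EuclideanSpace.single 2 1 : E3) := by
  obtain ⟨h1, h2⟩ := h
  simp only [base, Prod.mk.injEq] at h1
  ext i
  fin_cases i <;> simp [h1.1, h1.2]

theorem continuousAt_base {φ : OpenPartialHomeomorph M E3} {p : M} (hp : p ∈ φ.source) :
    ContinuousAt (base φ) p := by
  have h := φ.continuousAt hp
  have h0 : ∀ i : Fin 3, ContinuousAt (fun q => φ q i) p := fun i =>
    (EuclideanSpace.proj (𝕜 := ℝ) i).continuous.continuousAt.comp h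
  exact (h0 0).prodMk (h0 1)

theorem continuousAt_height {φ : OpenPartialHomeomorph M E3} {p : M} (hp : p ∈ φ.source) :
    ContinuousAt (fun q => φ q 2) p :=
  (EuclideanSpace.proj (𝕜 := ℝ) (2 : Fin 3)).continuous.continuousAt.comp (φ.continuousAt hp)

theorem eq_of_base_eq {φ : OpenPartialHomeomorph M E3} {p q : M} (hp : p ∈ φ.source)
    (hq : q ∈ φ.source) (h : base φ p = base φ q) (h2 : φ p 2 = φ q 2) : p = q := by
  apply φ.injOn hp hq
  simp only [base, Prod.mk.injEq] at h
  ext i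
  fin_cases i
  · exact h.1
  · exact h.2
  · exact h2

/-- A sheet through `p` has points near `p` over all points near the projection of `p`. -/
theorem eventually_exists_lift {φ : OpenPartialHomeomorph M E3} {p : M} (hp : p ∈ φ.source)
    {f : ℝ × ℝ → ℝ} (hf : Continuous f) (hfp : f (base φ p) = φ p 2) {V : Set M} (hV : V ∈ 𝓝 p) :
    ∀ᶠ u in 𝓝 (base φ p), ∃ q ∈ V, q ∈ φ.source ∧ base φ q = u ∧ φ q 2 = f u := by
  let g : ℝ × ℝ → E3 := fun u => !₂[u.1, u.2, f u]
  have hg : Continuous g := by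
    apply (PiLp.continuous_toLp 2 _).comp
    apply continuous_pi
    intro i
    fin_cases i
    · exact continuous_fst
    · exact continuous_snd
    · exact hf
  have hgp : g (base φ p) = φ p := by
    ext i
    fin_cases i
    · rfl
    · rfl
    · exact hfp
  have h1 : φ.target ∩ φ.symm ⁻¹' V ∈ 𝓝 (g (base φ p)) := by
    rw [hgp]
    apply Filter.inter_mem (φ.open_target.mem_nhds (φ.map_source hp))
    apply (φ.continuousAt_symm (φ.map_source hp)).preimage_mem_nhds
    rwa [φ.left_inv hp]
  filter_upwards [hg.continuousAt.preimage_mem_nhds h1] with u hu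
  refine ⟨φ.symm (g u), hu.2, φ.map_target hu.1, ?_, ?_⟩
  · simp [base, φ.right_inv hu.1, g]
  · simp [φ.right_inv hu.1, g]

variable [ChartedSpace E3 M] {X : ∀ p : M, TangentSpace (𝓡 3) p}

/-- The transition map between two flow boxes is differentiable, and its derivative multiplies
the vertical vector by a positive number. -/
theorem IsFlowBox.transition [IsManifold (𝓡 3) ∞ M] {φ Φ : OpenPartialHomeomorph M E3}
    (hφ : IsFlowBox X φ) (hΦ : IsFlowBox X Φ) {q : M} (hq : q ∈ φ.source) (hq' : q ∈ Φ.source) :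
    DifferentiableAt ℝ (Φ ∘ φ.symm) (φ q) ∧ ∃ r : ℝ, 0 < r ∧
      fderiv ℝ (Φ ∘ φ.symm) (φ q) (EuclideanSpace.single 2 1) =
        r • (EuclideanSpace.single 2 1 : E3) := by
  have h1 : ContMDiffAt (𝓡 3) (𝓡 3) ∞ φ.symm (φ q) :=
    contMDiffAt_symm_of_mem_maximalAtlas hφ.1 (φ.map_source hq)
  have h2 : ContMDiffAt (𝓡 3) (𝓡 3) ∞ Φ q := contMDiffAt_of_mem_maximalAtlas hΦ.1 hq'
  have h3 : ContMDiffAt (𝓡 3) (𝓡 3) ∞ φ q := contMDiffAt_of_mem_maximalAtlas hφ.1 hq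
  have h4 : ContMDiffAt (𝓡 3) (𝓡 3) ∞ (Φ ∘ φ.symm) (φ q) := by
    refine ContMDiffAt.comp (φ q) (I' := 𝓡 3) ?_ h1
    rwa [φ.left_inv hq]
  have h5 : DifferentiableAt ℝ (Φ ∘ φ.symm) (φ q) := by
    have := h4.mdifferentiableAt (by simp)
    exact mdifferentiableAt_iff_differentiableAt.1 this
  refine ⟨h5, ?_⟩
  obtain ⟨r, hr, hrX⟩ := hφ.2 q hq
  obtain ⟨r', hr', hrX'⟩ := hΦ.2 q hq'
  have h6 : mfderiv (𝓡 3) (𝓡 3) Φ q = (fderiv ℝ (Φ ∘ φ.symm) (φ q)).comp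
      (mfderiv (𝓡 3) (𝓡 3) φ q) := by
    have e : Φ =ᶠ[𝓝 q] (Φ ∘ φ.symm) ∘ φ := by
      filter_upwards [φ.open_source.mem_nhds hq] with s hs
      simp [φ.left_inv hs]
    rw [e.mfderiv_eq, mfderiv_comp q (h4.mdifferentiableAt (by simp))
      (h3.mdifferentiableAt (by simp)), mfderiv_eq_fderiv]
    rfl
  rw [h6] at hrX'
  have h7 : fderiv ℝ (Φ ∘ φ.symm) (φ q) (r • (EuclideanSpace.single 2 1 : E3)) =
      r' • (EuclideanSpace.single 2 1 : E3) := by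
    rw [← hrX', ← hrX]; rfl
  refine ⟨r⁻¹ * r', by positivity, ?_⟩
  rw [map_smul] at h7
  rw [mul_smul, ← h7, smul_smul, inv_mul_cancel₀ hr.ne', one_smul]

theorem exists_below_imp [IsManifold (𝓡 3) ∞ M] {φ Φ : OpenPartialHomeomorph M E3}
    (hφ : IsFlowBox X φ) (hΦ : IsFlowBox X Φ) {p : M} (hp : p ∈ φ.source) (hp' : p ∈ Φ.source) :
    ∃ V ∈ 𝓝 p, ∀ q ∈ V, ∀ q' ∈ V, Below φ q q' → Below Φ q q' := by
  have hN : φ.target ∩ φ.symm ⁻¹' Φ.source ∈ 𝓝 (φ p) := by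
    apply Filter.inter_mem (φ.open_target.mem_nhds (φ.map_source hp))
    apply (φ.continuousAt_symm (φ.map_source hp)).preimage_mem_nhds
    rw [φ.left_inv hp]
    exact Φ.open_source.mem_nhds hp'
  obtain ⟨ε, hε, hball⟩ := Metric.mem_nhds_iff.1 hN
  refine ⟨φ.source ∩ φ ⁻¹' Metric.ball (φ p) ε, Filter.inter_mem (φ.open_source.mem_nhds hp)
    ((φ.continuousAt hp).preimage_mem_nhds (Metric.ball_mem_nhds _ hε)), ?_⟩
  rintro q ⟨hqs, hqb⟩ q' ⟨hqs', hqb'⟩ hqq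
  set e : E3 := EuclideanSpace.single 2 1 with he
  set d := φ q' 2 - φ q 2 with hd
  have hd0 : 0 < d := sub_pos.2 hqq.2
  have hq'eq : φ q' = φ q + d • e := hqq.exists_eq
  have hmem : ∀ t ∈ Icc (0 : ℝ) d, φ q + t • e ∈ Metric.ball (φ p) ε := by
    intro t ht
    have := (convex_ball (φ p) ε).add_smul_mem (x := φ q) (y := d • e) hqb (by
      rw [← hq'eq]; exact hqb') (t := t / d) ⟨by have := ht.1; positivity, by
        rw [div_le_one hd0]; exact ht.2⟩
    rwa [smul_smul, div_mul_cancel₀ _ hd0.ne'] at this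
  have hder : ∀ t ∈ Icc (0 : ℝ) d, ∃ r : ℝ, 0 < r ∧
      HasDerivAt (fun s : ℝ => Φ (φ.symm (φ q + s • e))) (r • e) t := by
    intro t ht
    obtain ⟨ht1, ht2⟩ := hball (hmem t ht)
    obtain ⟨hdiff, r, hr, hrr⟩ := hφ.transition hΦ (φ.map_target ht1) ht2
    rw [φ.right_inv ht1] at hdiff hrr
    refine ⟨r, hr, ?_⟩
    have hl : HasDerivAt (fun s : ℝ => φ q + s • e) e t := by
      simpa using ((hasDerivAt_id t).smul_const e).const_add (φ q)
    have := hdiff.hasFDerivAt.comp_hasDerivAt t hl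
    rw [hrr] at this
    exact this
  have hcoord : ∀ i : Fin 3, ∀ t ∈ Icc (0 : ℝ) d, ∃ r : ℝ, 0 < r ∧
      HasDerivAt (fun s : ℝ => Φ (φ.symm (φ q + s • e)) i) (r * e i) t := by
    intro i t ht
    obtain ⟨r, hr, h⟩ := hder t ht
    exact ⟨r, hr, (EuclideanSpace.proj (𝕜 := ℝ) i).hasFDerivAt.comp_hasDerivAt t h⟩
  have hcont : ∀ i : Fin 3, ContinuousOn (fun s : ℝ => Φ (φ.symm (φ q + s • e)) i) (Icc 0 d) :=
    fun i t ht => by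
      obtain ⟨r, -, h⟩ := hcoord i t ht
      exact h.continuousAt.continuousWithinAt
  have hends : ∀ i, Φ (φ.symm (φ q + d • e)) i = Φ q' i ∧
      Φ (φ.symm (φ q + (0 : ℝ) • e)) i = Φ q i := fun i => by
    rw [← hq'eq, φ.left_inv hqs', zero_smul, add_zero, φ.left_inv hqs]; exact ⟨rfl, rfl⟩
  have hconst : ∀ i : Fin 3, e i = 0 → Φ q i = Φ q' i := by
    intro i hi
    rw [← (hends i).1, ← (hends i).2]
    symm
    apply constant_of_has_deriv_right_zero (hcont i) (fun t ht => ?_) d (right_mem_Icc.2 hd0.le)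
    obtain ⟨r, -, h⟩ := hcoord i t ⟨ht.1, ht.2.le⟩
    rw [hi, mul_zero] at h
    exact h.hasDerivWithinAt
  refine ⟨?_, ?_⟩
  · simp only [base]
    rw [hconst 0 (by simp [he]), hconst 1 (by simp [he])]
  · rw [← (hends 2).1, ← (hends 2).2]
    have hmono : StrictMonoOn (fun s : ℝ => Φ (φ.symm (φ q + s • e)) 2) (Icc 0 d) := by
      apply strictMonoOn_of_deriv_pos (convex_Icc 0 d) (hcont 2)
      intro t ht
      rw [interior_Icc] at ht
      obtain ⟨r, hr, h⟩ := hcoord 2 t ⟨ht.1.le, ht.2.le⟩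
      rw [h.deriv]
      simpa [he] using hr
    exact hmono (left_mem_Icc.2 hd0.le) (right_mem_Icc.2 hd0.le) hd0

/-- The order along the fibres near a point does not depend on the flow box. -/
theorem exists_below_iff [IsManifold (𝓡 3) ∞ M] {φ Φ : OpenPartialHomeomorph M E3}
    (hφ : IsFlowBox X φ) (hΦ : IsFlowBox X Φ) {p : M} (hp : p ∈ φ.source) (hp' : p ∈ Φ.source) :
    ∃ V ∈ 𝓝 p, ∀ q ∈ V, ∀ q' ∈ V, Below φ q q' ↔ Below Φ q q' := by
  obtain ⟨V, hV, h⟩ := exists_below_imp hφ hΦ hp hp'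
  obtain ⟨V', hV', h'⟩ := exists_below_imp hΦ hφ hp' hp
  exact ⟨V ∩ V', Filter.inter_mem hV hV', fun q hq q' hq' =>
    ⟨h q hq.1 q' hq'.1, h' q hq.2 q' hq'.2⟩⟩

/-- Near `p` every fibre meets `B` at most once. -/
def IsSimpleAt (X : ∀ p : M, TangentSpace (𝓡 3) p) (B : Set M) (p : M) : Prop :=
  ∃ φ : OpenPartialHomeomorph M E3, IsFlowBox X φ ∧ p ∈ φ.source ∧
    ∃ V ∈ 𝓝 p, ∀ q ∈ V ∩ B, ∀ q' ∈ V ∩ B, ¬ Below φ q q'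

/-- Near `p` every fibre meets `B` at most twice. -/
def IsAtMostDoubleAt (X : ∀ p : M, TangentSpace (𝓡 3) p) (B : Set M) (p : M) : Prop :=
  ∃ φ : OpenPartialHomeomorph M E3, IsFlowBox X φ ∧ p ∈ φ.source ∧
    ∃ V ∈ 𝓝 p, ∀ q ∈ V ∩ B, ∀ q' ∈ V ∩ B, ∀ q'' ∈ V ∩ B, ¬ (Below φ q q' ∧ Below φ q' q'')

theorem IsSimpleAt.of_flowBox [IsManifold (𝓡 3) ∞ M] {B : Set M} {p : M}
    (h : IsSimpleAt X B p) {Φ : OpenPartialHomeomorph M E3} (hΦ : IsFlowBox X Φ)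
    (hp : p ∈ Φ.source) : ∃ V ∈ 𝓝 p, ∀ q ∈ V ∩ B, ∀ q' ∈ V ∩ B, ¬ Below Φ q q' := by
  obtain ⟨φ, hφ, hpφ, V, hV, hVB⟩ := h
  obtain ⟨W, hW, hWW⟩ := exists_below_iff hφ hΦ hpφ hp
  exact ⟨V ∩ W, Filter.inter_mem hV hW, fun q hq q' hq' hb =>
    hVB q ⟨hq.1.1, hq.2⟩ q' ⟨hq'.1.1, hq'.2⟩ ((hWW q hq.1.2 q' hq'.1.2).2 hb)⟩

theorem IsAtMostDoubleAt.of_flowBox [IsManifold (𝓡 3) ∞ M] {B : Set M} {p : M}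
    (h : IsAtMostDoubleAt X B p) {Φ : OpenPartialHomeomorph M E3} (hΦ : IsFlowBox X Φ)
    (hp : p ∈ Φ.source) : ∃ V ∈ 𝓝 p, ∀ q ∈ V ∩ B, ∀ q' ∈ V ∩ B, ∀ q'' ∈ V ∩ B,
      ¬ (Below Φ q q' ∧ Below Φ q' q'') := by
  obtain ⟨φ, hφ, hpφ, V, hV, hVB⟩ := h
  obtain ⟨W, hW, hWW⟩ := exists_below_iff hφ hΦ hpφ hp
  exact ⟨V ∩ W, Filter.inter_mem hV hW, fun q hq q' hq' q'' hq'' hb =>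
    hVB q ⟨hq.1.1, hq.2⟩ q' ⟨hq'.1.1, hq'.2⟩ q'' ⟨hq''.1.1, hq''.2⟩
    ⟨(hWW q hq.1.2 q' hq'.1.2).2 hb.1, (hWW q' hq'.1.2 q'' hq''.1.2).2 hb.2⟩⟩

theorem IsSimpleAt.isAtMostDoubleAt {B : Set M} {p : M} (h : IsSimpleAt X B p) : IsAtMostDoubleAt X B p := by
  obtain ⟨φ, hφ, hpφ, V, hV, hVB⟩ := h
  exact ⟨φ, hφ, hpφ, V, hV, fun q hq q' hq' q'' _ hb => hVB q hq q' hq' hb.1⟩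

end Fibres

/-! ### Stacks of three sheets with two openings -/

section GapCharts

variable {M : Type*} [TopologicalSpace M] [ChartedSpace E3 M]
  {X : ∀ p : M, TangentSpace (𝓡 3) p}

/-- In the open part `W` of a flow box, `B` is a stack of three sheets `z = f₀ ≤ f₁ ≤ f₂`; the
lower two separate exactly where `α > 0`, the upper two exactly where `β > 0`.  All local models
and all boxes around an arc of splitting have this form; when there are only two sheets, `f₂ = f₁`
and `β = -1`. -/
structure IsGapChart (X : ∀ p : M, TangentSpace (𝓡 3) p) (B : Set M)
    (Φ : OpenPartialHomeomorph M E3) (W : Set M) (f₀ f₁ f₂ α β : ℝ × ℝ → ℝ) : Prop where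
  flowBox : IsFlowBox X Φ
  isOpen : IsOpen W
  subset : W ⊆ Φ.source
  cont₀ : Continuous f₀
  cont₁ : Continuous f₁
  cont₂ : Continuous f₂
  contα : Continuous α
  contβ : Continuous β
  le₀₁ : ∀ q ∈ W, f₀ (base Φ q) ≤ f₁ (base Φ q)
  le₁₂ : ∀ q ∈ W, f₁ (base Φ q) ≤ f₂ (base Φ q)
  lt₀₁ : ∀ q ∈ W, (f₀ (base Φ q) < f₁ (base Φ q) ↔ 0 < α (base Φ q))
  lt₁₂ : ∀ q ∈ W, (f₁ (base Φ q) < f₂ (base Φ q) ↔ 0 < β (base Φ q))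
  mem_iff : ∀ q ∈ W, (q ∈ B ↔ Φ q 2 = f₀ (base Φ q) ∨ Φ q 2 = f₁ (base Φ q) ∨
    Φ q 2 = f₂ (base Φ q))

namespace IsGapChart

variable {B : Set M} {Φ : OpenPartialHomeomorph M E3} {W : Set M} {f₀ f₁ f₂ α β : ℝ × ℝ → ℝ}
  {p : M}

theorem mem_nhds (h : IsGapChart X B Φ W f₀ f₁ f₂ α β) (hp : p ∈ W) : W ∈ 𝓝 p :=
  h.isOpen.mem_nhds hp

theorem continuousAt_comp (h : IsGapChart X B Φ W f₀ f₁ f₂ α β) (hp : p ∈ W)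
    {f : ℝ × ℝ → ℝ} (hf : Continuous f) : ContinuousAt (fun q => f (base Φ q)) p :=
  hf.continuousAt.comp (continuousAt_base (h.subset hp))

theorem isSimpleAt_of_graph (h : IsGapChart X B Φ W f₀ f₁ f₂ α β) (hp : p ∈ W)
    {f : ℝ × ℝ → ℝ} (hf : ∀ᶠ q in 𝓝 p, q ∈ B → Φ q 2 = f (base Φ q)) : IsSimpleAt X B p := by
  refine ⟨Φ, h.flowBox, h.subset hp, _, hf, ?_⟩
  rintro q ⟨hq, hqB⟩ q' ⟨hq', hqB'⟩ ⟨hb, hlt⟩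
  have h1 : Φ q 2 = f (base Φ q) := hq hqB
  have h2 : Φ q' 2 = f (base Φ q') := hq' hqB'
  rw [h1, h2, hb] at hlt
  exact lt_irrefl _ hlt

/-- Two sheets meet near `p` only if `p` is on the middle sheet and on the edge of an opening. -/
theorem isSimpleAt (h : IsGapChart X B Φ W f₀ f₁ f₂ α β) (hp : p ∈ W) (hpB : p ∈ B)
    (hne : ¬ (Φ p 2 = f₁ (base Φ p) ∧ (α (base Φ p) = 0 ∨ β (base Φ p) = 0))) :
    IsSimpleAt X B p := by
  have hz := continuousAt_height (h.subset hp)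
  have c0 := h.continuousAt_comp hp h.cont₀
  have c1 := h.continuousAt_comp hp h.cont₁
  have c2 := h.continuousAt_comp hp h.cont₂
  have cα := h.continuousAt_comp hp h.contα
  have cβ := h.continuousAt_comp hp h.contβ
  have l01 := h.le₀₁ p hp
  have l12 := h.le₁₂ p hp
  by_cases h1 : Φ p 2 = f₁ (base Φ p)
  · have hα : α (base Φ p) ≠ 0 := fun e => hne ⟨h1, Or.inl e⟩
    have hβ : β (base Φ p) ≠ 0 := fun e => hne ⟨h1, Or.inr e⟩
    apply h.isSimpleAt_of_graph hp (f := f₁)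
    have e0 : ∀ᶠ q in 𝓝 p, Φ q 2 = f₀ (base Φ q) → Φ q 2 = f₁ (base Φ q) := by
      rcases lt_or_gt_of_ne hα with hα | hα
      · filter_upwards [h.mem_nhds hp, cα.eventually_lt continuousAt_const hα] with q hq hqα hq0
        rw [hq0]
        exact le_antisymm (h.le₀₁ q hq) (not_lt.1 fun hlt => by
          have := (h.lt₀₁ q hq).1 hlt; linarith)
      · have := (h.lt₀₁ p hp).2 hα
        filter_upwards [c0.eventually_lt hz (by simpa only [h1] using this)] with q hq hq0
        exact absurd hq0 hq.ne'
    have e2 : ∀ᶠ q in 𝓝 p, Φ q 2 = f₂ (base Φ q) → Φ q 2 = f₁ (base Φ q) := by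
      rcases lt_or_gt_of_ne hβ with hβ | hβ
      · filter_upwards [h.mem_nhds hp, cβ.eventually_lt continuousAt_const hβ] with q hq hqβ hq0
        rw [hq0]
        exact (le_antisymm (h.le₁₂ q hq) (not_lt.1 fun hlt => by
          have := (h.lt₁₂ q hq).1 hlt; linarith)).symm
      · have := (h.lt₁₂ p hp).2 hβ
        filter_upwards [hz.eventually_lt c2 (by simpa only [h1] using this)] with q hq hq0
        exact absurd hq0 hq.ne
    filter_upwards [h.mem_nhds hp, e0, e2] with q hq hq0 hq2 hqB
    rcases (h.mem_iff q hq).1 hqB with e | e | e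
    exacts [hq0 e, e, hq2 e]
  · rcases (h.mem_iff p hp).1 hpB with e | e | e
    · apply h.isSimpleAt_of_graph hp (f := f₀)
      have l1 : Φ p 2 < f₁ (base Φ p) := lt_of_le_of_ne (e ▸ l01) h1
      filter_upwards [h.mem_nhds hp, hz.eventually_lt c1 l1,
        hz.eventually_lt c2 (l1.trans_le l12)] with q hq hq1 hq2 hqB
      rcases (h.mem_iff q hq).1 hqB with e | e | e
      exacts [e, absurd e hq1.ne, absurd e hq2.ne]
    · exact absurd e h1
    · apply h.isSimpleAt_of_graph hp (f := f₂)
      have l1 : f₁ (base Φ p) < Φ p 2 := lt_of_le_of_ne (e ▸ l12) (Ne.symm h1)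
      filter_upwards [h.mem_nhds hp, c1.eventually_lt hz l1,
        c0.eventually_lt hz (l01.trans_lt l1)] with q hq hq1 hq2 hqB
      rcases (h.mem_iff q hq).1 hqB with e | e | e
      exacts [absurd e hq2.ne', absurd e hq1.ne', e]

theorem mid_of_not_isSimpleAt (h : IsGapChart X B Φ W f₀ f₁ f₂ α β) (hp : p ∈ W) (hpB : p ∈ B)
    (hns : ¬ IsSimpleAt X B p) :
    Φ p 2 = f₁ (base Φ p) ∧ (α (base Φ p) = 0 ∨ β (base Φ p) = 0) := by
  by_contra hne
  exact hns (h.isSimpleAt hp hpB hne)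

theorem isAtMostDoubleAt (h : IsGapChart X B Φ W f₀ f₁ f₂ α β) (hp : p ∈ W) (hpB : p ∈ B)
    (hne : α (base Φ p) ≠ 0 ∨ β (base Φ p) ≠ 0) : IsAtMostDoubleAt X B p := by
  by_cases hs : IsSimpleAt X B p
  · exact hs.isAtMostDoubleAt
  obtain ⟨h1, -⟩ := h.mid_of_not_isSimpleAt hp hpB hs
  have hz := continuousAt_height (h.subset hp)
  -- It is enough that one of the outer sheets does not come near `p` as a separate sheet.
  have key : ∃ f f' : ℝ × ℝ → ℝ, ∀ᶠ q in 𝓝 p,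
      q ∈ B → Φ q 2 = f (base Φ q) ∨ Φ q 2 = f' (base Φ q) := by
    rcases hne with hα | hβ
    · refine ⟨f₁, f₂, ?_⟩
      rcases lt_or_gt_of_ne hα with hα | hα
      · filter_upwards [h.mem_nhds hp, (h.continuousAt_comp hp h.contα).eventually_lt
          continuousAt_const hα] with q hq hqα hqB
        have e01 : f₀ (base Φ q) = f₁ (base Φ q) := le_antisymm (h.le₀₁ q hq)
          (not_lt.1 fun hlt => by have := (h.lt₀₁ q hq).1 hlt; linarith)
        rcases (h.mem_iff q hq).1 hqB with e | e | e
        exacts [Or.inl (e.trans e01), Or.inl e, Or.inr e]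
      · have := (h.lt₀₁ p hp).2 hα
        filter_upwards [h.mem_nhds hp, (h.continuousAt_comp hp h.cont₀).eventually_lt hz
          (by simpa only [h1] using this)] with q hq hq0 hqB
        rcases (h.mem_iff q hq).1 hqB with e | e | e
        exacts [absurd e hq0.ne', Or.inl e, Or.inr e]
    · refine ⟨f₁, f₀, ?_⟩
      rcases lt_or_gt_of_ne hβ with hβ | hβ
      · filter_upwards [h.mem_nhds hp, (h.continuousAt_comp hp h.contβ).eventually_lt
          continuousAt_const hβ] with q hq hqβ hqB
        have e12 : f₁ (base Φ q) = f₂ (base Φ q) := le_antisymm (h.le₁₂ q hq)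
          (not_lt.1 fun hlt => by have := (h.lt₁₂ q hq).1 hlt; linarith)
        rcases (h.mem_iff q hq).1 hqB with e | e | e
        exacts [Or.inr e, Or.inl e, Or.inl (e.trans e12.symm)]
      · have := (h.lt₁₂ p hp).2 hβ
        filter_upwards [h.mem_nhds hp, hz.eventually_lt (h.continuousAt_comp hp h.cont₂)
          (by simpa only [h1] using this)] with q hq hq0 hqB
        rcases (h.mem_iff q hq).1 hqB with e | e | e
        exacts [Or.inr e, Or.inl e, absurd e hq0.ne]
  obtain ⟨f, f', hff⟩ := key
  refine ⟨Φ, h.flowBox, h.subset hp, _, hff, ?_⟩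
  rintro q ⟨hq, hqB⟩ q' ⟨hq', hqB'⟩ q'' ⟨hq'', hqB''⟩ ⟨⟨b1, l1⟩, ⟨b2, l2⟩⟩
  have e1 : Φ q 2 = f (base Φ q) ∨ Φ q 2 = f' (base Φ q) := hq hqB
  have e2 : Φ q' 2 = f (base Φ q') ∨ Φ q' 2 = f' (base Φ q') := hq' hqB'
  have e3 : Φ q'' 2 = f (base Φ q'') ∨ Φ q'' 2 = f' (base Φ q'') := hq'' hqB''
  rw [b1, b2] at e1
  rw [b2] at e2
  grind

theorem not_isSimpleAt_of_α [IsManifold (𝓡 3) ∞ M] (h : IsGapChart X B Φ W f₀ f₁ f₂ α β)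
    (hp : p ∈ W) (h1 : Φ p 2 = f₁ (base Φ p)) (hα : α (base Φ p) = 0)
    (hf : ∃ᶠ u in 𝓝 (base Φ p), 0 < α u) : ¬ IsSimpleAt X B p := by
  intro hs
  obtain ⟨V, hV, hVB⟩ := hs.of_flowBox h.flowBox (h.subset hp)
  have e01 : f₀ (base Φ p) = f₁ (base Φ p) := le_antisymm (h.le₀₁ p hp)
    (not_lt.1 fun hlt => by have := (h.lt₀₁ p hp).1 hlt; linarith)
  have hVW := Filter.inter_mem hV (h.mem_nhds hp)
  obtain ⟨u, hu, ⟨q, ⟨hqV, hqW⟩, -, hqu, hq2⟩, ⟨q', ⟨hqV', hqW'⟩, -, hqu', hq2'⟩⟩ :=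
    (hf.and_eventually ((eventually_exists_lift (h.subset hp) h.cont₀ (e01.trans h1.symm)
      hVW).and (eventually_exists_lift (h.subset hp) h.cont₁ h1.symm hVW))).exists
  refine hVB q ⟨hqV, (h.mem_iff q hqW).2 (Or.inl (by rw [hq2, hqu]))⟩ q'
    ⟨hqV', (h.mem_iff q' hqW').2 (Or.inr (Or.inl (by rw [hq2', hqu'])))⟩
    ⟨hqu.trans hqu'.symm, ?_⟩
  rw [hq2, hq2', ← hqu]
  exact (h.lt₀₁ q hqW).2 (hqu ▸ hu)

theorem not_isSimpleAt_of_β [IsManifold (𝓡 3) ∞ M] (h : IsGapChart X B Φ W f₀ f₁ f₂ α β)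
    (hp : p ∈ W) (h1 : Φ p 2 = f₁ (base Φ p)) (hβ : β (base Φ p) = 0)
    (hf : ∃ᶠ u in 𝓝 (base Φ p), 0 < β u) : ¬ IsSimpleAt X B p := by
  intro hs
  obtain ⟨V, hV, hVB⟩ := hs.of_flowBox h.flowBox (h.subset hp)
  have e12 : f₁ (base Φ p) = f₂ (base Φ p) := le_antisymm (h.le₁₂ p hp)
    (not_lt.1 fun hlt => by have := (h.lt₁₂ p hp).1 hlt; linarith)
  have hVW := Filter.inter_mem hV (h.mem_nhds hp)
  obtain ⟨u, hu, ⟨q, ⟨hqV, hqW⟩, -, hqu, hq2⟩, ⟨q', ⟨hqV', hqW'⟩, -, hqu', hq2'⟩⟩ :=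
    (hf.and_eventually ((eventually_exists_lift (h.subset hp) h.cont₁ h1.symm
      hVW).and (eventually_exists_lift (h.subset hp) h.cont₂ (e12.symm.trans h1.symm)
      hVW))).exists
  refine hVB q ⟨hqV, (h.mem_iff q hqW).2 (Or.inr (Or.inl (by rw [hq2, hqu])))⟩ q'
    ⟨hqV', (h.mem_iff q' hqW').2 (Or.inr (Or.inr (by rw [hq2', hqu'])))⟩
    ⟨hqu.trans hqu'.symm, ?_⟩
  rw [hq2, hq2', ← hqu]
  exact (h.lt₁₂ q hqW).2 (hqu ▸ hu)

theorem not_isAtMostDoubleAt [IsManifold (𝓡 3) ∞ M] (h : IsGapChart X B Φ W f₀ f₁ f₂ α β)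
    (hp : p ∈ W) (h1 : Φ p 2 = f₁ (base Φ p)) (hα : α (base Φ p) = 0) (hβ : β (base Φ p) = 0)
    (hf : ∃ᶠ u in 𝓝 (base Φ p), 0 < α u ∧ 0 < β u) : ¬ IsAtMostDoubleAt X B p := by
  intro hs
  obtain ⟨V, hV, hVB⟩ := hs.of_flowBox h.flowBox (h.subset hp)
  have e01 : f₀ (base Φ p) = f₁ (base Φ p) := le_antisymm (h.le₀₁ p hp)
    (not_lt.1 fun hlt => by have := (h.lt₀₁ p hp).1 hlt; linarith)
  have e12 : f₁ (base Φ p) = f₂ (base Φ p) := le_antisymm (h.le₁₂ p hp)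
    (not_lt.1 fun hlt => by have := (h.lt₁₂ p hp).1 hlt; linarith)
  have hVW := Filter.inter_mem hV (h.mem_nhds hp)
  obtain ⟨u, ⟨huα, huβ⟩, ⟨q, ⟨hqV, hqW⟩, -, hqu, hq2⟩, ⟨q', ⟨hqV', hqW'⟩, -, hqu', hq2'⟩,
      ⟨q'', ⟨hqV'', hqW''⟩, -, hqu'', hq2''⟩⟩ :=
    (hf.and_eventually ((eventually_exists_lift (h.subset hp) h.cont₀ (e01.trans h1.symm)
      hVW).and ((eventually_exists_lift (h.subset hp) h.cont₁ h1.symm hVW).and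
      (eventually_exists_lift (h.subset hp) h.cont₂ (e12.symm.trans h1.symm) hVW)))).exists
  refine hVB q ⟨hqV, (h.mem_iff q hqW).2 (Or.inl (by rw [hq2, hqu]))⟩ q'
    ⟨hqV', (h.mem_iff q' hqW').2 (Or.inr (Or.inl (by rw [hq2', hqu'])))⟩ q''
    ⟨hqV'', (h.mem_iff q'' hqW'').2 (Or.inr (Or.inr (by rw [hq2'', hqu''])))⟩
    ⟨⟨hqu.trans hqu'.symm, ?_⟩, ⟨hqu'.trans hqu''.symm, ?_⟩⟩
  · rw [hq2, hq2', ← hqu]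
    exact (h.lt₀₁ q hqW).2 (hqu ▸ huα)
  · rw [hq2', hq2'', ← hqu']
    exact (h.lt₁₂ q' hqW').2 (hqu' ▸ huβ)

end IsGapChart

end GapCharts

/-! ### The local models and their strands -/

section Models

variable {M : Type*} [TopologicalSpace M]

/-- The lower (`false`) or upper (`true`) smooth branch of the singular locus in a chart. -/
def strand (φ : OpenPartialHomeomorph M E3) : Bool → Set M
  | false => lowerStrand φ
  | true => upperStrand φ

theorem base_eq_zero {φ : OpenPartialHomeomorph M E3} {p : M} (h : φ p = 0) :
    base φ p = 0 := by
  simp [base, h]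

theorem eq_of_mem_strands {φ : OpenPartialHomeomorph M E3} {p q : M} (hp : p ∈ φ.source)
    (h : φ p = 0) (h₁ : q ∈ lowerStrand φ) (h₂ : q ∈ upperStrand φ) : q = p := by
  apply eq_of_base_eq h₁.1 hp
  · rw [base_eq_zero h]
    exact Prod.ext h₁.2.1 h₂.2.1
  · simp [h, h₁.2.2]

theorem frequently_fst_pos {u : ℝ × ℝ} (hu : u.1 = 0) : ∃ᶠ v in 𝓝 u, 0 < v.1 := by
  have hc : Continuous fun t : ℝ => (t, u.2) := by fun_prop
  have h : Tendsto (fun t : ℝ => (t, u.2)) (𝓝[>] 0) (𝓝 u) := by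
    have := (hc.tendsto 0).mono_left (nhdsWithin_le_nhds (s := Ioi (0 : ℝ)))
    rwa [show ((0 : ℝ), u.2) = u from Prod.ext hu.symm rfl] at this
  have hev : ∀ᶠ t : ℝ in 𝓝[>] 0, 0 < t := eventually_mem_nhdsWithin
  exact h.frequently hev.frequently

theorem frequently_snd_pos {u : ℝ × ℝ} (hu : u.2 = 0) : ∃ᶠ v in 𝓝 u, 0 < v.2 := by
  have hc : Continuous fun t : ℝ => (u.1, t) := by fun_prop
  have h : Tendsto (fun t : ℝ => (u.1, t)) (𝓝[>] 0) (𝓝 u) := by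
    have := (hc.tendsto 0).mono_left (nhdsWithin_le_nhds (s := Ioi (0 : ℝ)))
    rwa [show (u.1, (0 : ℝ)) = u from Prod.ext rfl hu.symm] at this
  have hev : ∀ᶠ t : ℝ in 𝓝[>] 0, 0 < t := eventually_mem_nhdsWithin
  exact h.frequently hev.frequently

theorem frequently_both_pos : ∃ᶠ v in 𝓝 (0 : ℝ × ℝ), 0 < v.1 ∧ 0 < v.2 := by
  have hc : Continuous fun t : ℝ => (t, t) := by fun_prop
  have h : Tendsto (fun t : ℝ => (t, t)) (𝓝[>] 0) (𝓝 (0 : ℝ × ℝ)) :=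
    (hc.tendsto 0).mono_left nhdsWithin_le_nhds
  have hev : ∀ᶠ t : ℝ in 𝓝[>] 0, 0 < t ∧ 0 < t :=
    eventually_mem_nhdsWithin.mono fun t (ht : 0 < t) => ⟨ht, ht⟩
  exact h.frequently hev.frequently

theorem exists_open_of_eventually {φ : OpenPartialHomeomorph M E3} {p : M}
    (hp : p ∈ φ.source) {P : M → Prop} (h : ∀ᶠ q in 𝓝 p, P q) :
    ∃ W, IsOpen W ∧ p ∈ W ∧ W ⊆ φ.source ∧ ∀ q ∈ W, P q := by
  obtain ⟨W, hW, hWo, hpW⟩ := eventually_nhds_iff.1 (h.and (φ.open_source.mem_nhds hp))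
  exact ⟨W, hWo, hpW, fun q hq => (hW q hq).2, fun q hq => (hW q hq).1⟩

variable [ChartedSpace E3 M] {X : ∀ p : M, TangentSpace (𝓡 3) p} {B : Set M} {p : M}
  {φ : OpenPartialHomeomorph M E3}

theorem IsBranchModel.exists_gapChart (h : IsBranchModel X B p φ) :
    ∃ W, p ∈ W ∧ ∃ b : ℝ × ℝ → ℝ,
      IsGapChart X B φ W (fun _ => 0) b b Prod.fst (fun _ => -1) := by
  obtain ⟨⟨hφ, hp, hφp⟩, b, hb, hbp, hB⟩ := h
  have hbp' : ∀ᶠ q in 𝓝 p, 0 ≤ b (base φ q) ∧ (0 < b (base φ q) ↔ 0 < (base φ q).1) := by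
    rw [← base_eq_zero hφp] at hbp
    exact (continuousAt_base hp).eventually hbp
  obtain ⟨W, hWo, hpW, hWs, hW⟩ := exists_open_of_eventually hp (hbp'.and hB)
  refine ⟨W, hpW, b, ⟨hφ, hWo, hWs, continuous_const, hb.continuous, hb.continuous,
    continuous_fst, continuous_const, fun q hq => (hW q hq).1.1, fun q hq => le_rfl,
    fun q hq => (hW q hq).1.2, fun q hq => ?_, fun q hq => ?_⟩⟩
  · norm_num
  · rw [(hW q hq).2]
    simp only [base, or_self]

theorem IsDoubleModel.exists_gapChart (h : IsDoubleModel X B p φ) :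
    ∃ W, p ∈ W ∧ ∃ a b : ℝ × ℝ → ℝ,
      IsGapChart X B φ W a (fun _ => 0) b Prod.fst Prod.snd := by
  obtain ⟨⟨hφ, hp, hφp⟩, a, b, ha, hb, hap, hbp, hB⟩ := h
  have hap' : ∀ᶠ q in 𝓝 p, 0 ≤ a (base φ q) ∧ (0 < a (base φ q) ↔ 0 < (base φ q).1) := by
    rw [← base_eq_zero hφp] at hap
    exact (continuousAt_base hp).eventually hap
  have hbp' : ∀ᶠ q in 𝓝 p, 0 ≤ b (base φ q) ∧ (0 < b (base φ q) ↔ 0 < (base φ q).2) := by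
    rw [← base_eq_zero hφp] at hbp
    exact (continuousAt_base hp).eventually hbp
  obtain ⟨W, hWo, hpW, hWs, hW⟩ := exists_open_of_eventually hp (hap'.and (hbp'.and hB))
  refine ⟨W, hpW, fun u => -a u, b, ⟨hφ, hWo, hWs, ha.continuous.neg, continuous_const,
    hb.continuous, continuous_fst, continuous_snd, fun q hq => ?_, fun q hq => (hW q hq).2.1.1,
    fun q hq => ?_, fun q hq => (hW q hq).2.1.2, fun q hq => ?_⟩⟩
  · have := (hW q hq).1.1
    simpa using this
  · simpa using (hW q hq).1.2
  · rw [(hW q hq).2.2]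
    rfl

theorem IsRegularModel.isSimpleAt (h : IsRegularModel X B p φ) : IsSimpleAt X B p := by
  obtain ⟨⟨hφ, hp, hφp⟩, hB⟩ := h
  refine ⟨φ, hφ, hp, _, hB, ?_⟩
  rintro q ⟨hq, hqB⟩ q' ⟨hq', hqB'⟩ ⟨-, hlt⟩
  have h1 : φ q 2 = 0 := hq.1 hqB
  have h2 : φ q' 2 = 0 := hq'.1 hqB'
  exact absurd hlt (by rw [h1, h2]; exact lt_irrefl _)

theorem IsBranchModel.mem (h : IsBranchModel X B p φ) : p ∈ B := by
  obtain ⟨⟨-, -, hφp⟩, b, -, -, hB⟩ := h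
  exact hB.self_of_nhds.2 (Or.inl (by simp [hφp]))

theorem IsDoubleModel.mem (h : IsDoubleModel X B p φ) : p ∈ B := by
  obtain ⟨⟨-, -, hφp⟩, a, b, -, -, -, -, hB⟩ := h
  exact hB.self_of_nhds.2 (Or.inr (Or.inl (by simp [hφp])))

theorem IsBranchModel.isAtMostDoubleAt (h : IsBranchModel X B p φ) : IsAtMostDoubleAt X B p := by
  obtain ⟨W, hp, b, hg⟩ := h.exists_gapChart
  exact hg.isAtMostDoubleAt hp h.mem (Or.inr (by norm_num))

/-- `φ` is a chart at `p` adapted to the point of the singular locus, made smooth by separating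
its two branches at each double point, that the pair `(p, σ)` encodes: `σ = false` for a branch
point or for the lower branch at a double point, `σ = true` for the upper branch at a double
point. -/
def IsLiftChart (X : ∀ p : M, TangentSpace (𝓡 3) p) (B : Set M) (p : M) (σ : Bool)
    (φ : OpenPartialHomeomorph M E3) : Prop :=
  (σ = false ∧ IsBranchModel X B p φ) ∨ IsDoubleModel X B p φ

namespace IsLiftChart

variable {σ : Bool}

theorem flowBoxAt (h : IsLiftChart X B p σ φ) : IsFlowBoxAt X p φ := by
  rcases h with ⟨-, h⟩ | h
  exacts [h.1, h.1]

theorem mem (h : IsLiftChart X B p σ φ) : p ∈ B := by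
  rcases h with ⟨-, h⟩ | h
  exacts [h.mem, h.mem]

theorem self_mem_strand (h : IsLiftChart X B p σ φ) : p ∈ strand φ σ := by
  have h1 := h.flowBoxAt
  cases σ
  · exact ⟨h1.2.1, by simp [h1.2.2], by simp [h1.2.2]⟩
  · exact ⟨h1.2.1, by simp [h1.2.2], by simp [h1.2.2]⟩

/-- Points of the singular locus near the centre are on a strand. -/
theorem eventually_mem_strand (h : IsLiftChart X B p σ φ) : ∀ᶠ q in 𝓝 p, q ∈ B →
    ¬ IsSimpleAt X B q → q ∈ lowerStrand φ ∨ IsDoubleModel X B p φ ∧ q ∈ upperStrand φ := by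
  rcases h with ⟨-, h⟩ | h
  · obtain ⟨W, hp, b, hg⟩ := h.exists_gapChart
    filter_upwards [hg.mem_nhds hp] with q hq hqB hns
    obtain ⟨h1, h2 | h2⟩ := hg.mid_of_not_isSimpleAt hq hqB hns
    · left
      refine ⟨hg.subset hq, h2, ?_⟩
      rw [h1]
      exact le_antisymm (not_lt.1 fun hlt => ((hg.lt₀₁ q hq).1 hlt).ne' h2) (hg.le₀₁ q hq)
    · norm_num at h2
  · obtain ⟨W, hp, a, b, hg⟩ := h.exists_gapChart
    filter_upwards [hg.mem_nhds hp] with q hq hqB hns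
    obtain ⟨h1, h2 | h2⟩ := hg.mid_of_not_isSimpleAt hq hqB hns
    · exact Or.inl ⟨hg.subset hq, h2, h1⟩
    · exact Or.inr ⟨h, hg.subset hq, h2, h1⟩

theorem eventually_isAtMostDoubleAt (h : IsLiftChart X B p σ φ) : ∀ᶠ q in 𝓝 p, q ∈ B →
    q ≠ p → IsAtMostDoubleAt X B q := by
  rcases h with ⟨-, h⟩ | h
  · obtain ⟨W, hp, b, hg⟩ := h.exists_gapChart
    filter_upwards [hg.mem_nhds hp] with q hq hqB _
    exact hg.isAtMostDoubleAt hq hqB (Or.inr (by norm_num))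
  · obtain ⟨W, hp, a, b, hg⟩ := h.exists_gapChart
    filter_upwards [hg.mem_nhds hp] with q hq hqB hqp
    by_cases hs : IsSimpleAt X B q
    · exact hs.isAtMostDoubleAt
    apply hg.isAtMostDoubleAt hq hqB
    by_contra! hne
    exact hqp (eq_of_mem_strands (hg.subset hp) h.1.2.2
      ⟨hg.subset hq, hne.1, (hg.mid_of_not_isSimpleAt hq hqB hs).1⟩
      ⟨hg.subset hq, hne.2, (hg.mid_of_not_isSimpleAt hq hqB hs).1⟩)

variable [IsManifold (𝓡 3) ∞ M]

theorem eventually_not_isSimpleAt (h : IsLiftChart X B p σ φ) : ∀ᶠ q in 𝓝 p,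
    q ∈ strand φ σ → q ∈ B ∧ ¬ IsSimpleAt X B q := by
  rcases h with ⟨rfl, h⟩ | h
  · obtain ⟨W, hp, b, hg⟩ := h.exists_gapChart
    filter_upwards [hg.mem_nhds hp] with q hq hqs
    have hqs' : q ∈ lowerStrand φ := hqs
    have hx : (base φ q).1 = 0 := hqs'.2.1
    have hb : b (base φ q) = 0 :=
      le_antisymm (not_lt.1 fun hlt => ((hg.lt₀₁ q hq).1 hlt).ne' hx) (hg.le₀₁ q hq)
    exact ⟨(hg.mem_iff q hq).2 (Or.inl hqs'.2.2),
      hg.not_isSimpleAt_of_α hq (hqs'.2.2.trans hb.symm) hx (frequently_fst_pos hx)⟩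
  · obtain ⟨W, hp, a, b, hg⟩ := h.exists_gapChart
    filter_upwards [hg.mem_nhds hp] with q hq hqs
    cases σ
    · have hqs' : q ∈ lowerStrand φ := hqs
      exact ⟨(hg.mem_iff q hq).2 (Or.inr (Or.inl hqs'.2.2)),
        hg.not_isSimpleAt_of_α hq hqs'.2.2 hqs'.2.1 (frequently_fst_pos hqs'.2.1)⟩
    · have hqs' : q ∈ upperStrand φ := hqs
      exact ⟨(hg.mem_iff q hq).2 (Or.inr (Or.inl hqs'.2.2)),
        hg.not_isSimpleAt_of_β hq hqs'.2.2 hqs'.2.1 (frequently_snd_pos hqs'.2.1)⟩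

theorem not_isSimpleAt (h : IsLiftChart X B p σ φ) : ¬ IsSimpleAt X B p :=
  (h.eventually_not_isSimpleAt.self_of_nhds h.self_mem_strand).2

end IsLiftChart

variable [IsManifold (𝓡 3) ∞ M]

theorem IsDoubleModel.not_isAtMostDoubleAt (h : IsDoubleModel X B p φ) :
    ¬ IsAtMostDoubleAt X B p := by
  obtain ⟨W, hp, a, b, hg⟩ := h.exists_gapChart
  have h0 := base_eq_zero h.1.2.2
  refine hg.not_isAtMostDoubleAt hp (by simp [h.1.2.2]) (by simp [h0]) (by simp [h0]) ?_
  rw [h0]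
  exact frequently_both_pos

theorem IsDoubleModel.not_isBranchModel {ψ : OpenPartialHomeomorph M E3}
    (h : IsDoubleModel X B p φ) : ¬ IsBranchModel X B p ψ :=
  fun h' => h.not_isAtMostDoubleAt h'.isAtMostDoubleAt

theorem IsBranchedSurface.exists_isBranchModel (hB : IsBranchedSurface X B) (hp : p ∈ B)
    (hs : ¬ IsSimpleAt X B p) (hd : IsAtMostDoubleAt X B p) : ∃ φ, IsBranchModel X B p φ := by
  obtain ⟨φ, h | h | h⟩ := hB p hp
  · exact absurd h.isSimpleAt hs
  · exact ⟨φ, h⟩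
  · exact absurd hd h.not_isAtMostDoubleAt

theorem IsLiftChart.eventually_exists_isBranchModel {σ : Bool} (h : IsLiftChart X B p σ φ)
    (hB : IsBranchedSurface X B) :
    ∀ᶠ q in 𝓝 p, q ∈ strand φ σ → q ≠ p → ∃ ψ, IsBranchModel X B q ψ := by
  filter_upwards [h.eventually_not_isSimpleAt, h.eventually_isAtMostDoubleAt] with q h1 h2 hq hqp
  exact hB.exists_isBranchModel (h1 hq).1 (h1 hq).2 (h2 (h1 hq).1 hqp)

theorem IsBranchModel.not_isLiftChart_true {ψ : OpenPartialHomeomorph M E3}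
    (h : IsBranchModel X B p φ) : ¬ IsLiftChart X B p true ψ := by
  rintro (⟨h1, -⟩ | h1)
  · exact absurd h1 (by simp)
  · exact h1.not_isBranchModel h

/-- Near a point of a strand other than the centre, the strands of all charts centred at that
point coincide with the given strand. -/
theorem IsLiftChart.eventually_lowerStrand_iff {σ : Bool} (h : IsLiftChart X B p σ φ) :
    ∀ᶠ q in 𝓝 p, q ∈ strand φ σ → q ≠ p → ∀ ψ, IsBranchModel X B q ψ →
      ∀ᶠ q' in 𝓝 q, (q' ∈ lowerStrand ψ ↔ q' ∈ strand φ σ) := by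
  have hp := h.flowBoxAt
  filter_upwards [h.eventually_not_isSimpleAt.eventually_nhds,
    h.eventually_mem_strand.eventually_nhds] with q h1 h2 hq hqp ψ hψ
  have hψ' : IsLiftChart X B q false ψ := Or.inl ⟨rfl, hψ⟩
  have hsrc : q ∈ φ.source := by
    cases σ
    exacts [hq.1, hq.1]
  have hcont : ContinuousAt (base φ) q := continuousAt_base hsrc
  have hother : ∀ᶠ q' in 𝓝 q, q' ∉ strand φ (!σ) := by
    cases σ
    · have hne : (base φ q).2 ≠ 0 := fun e =>
        hqp (eq_of_mem_strands hp.2.1 hp.2.2 hq ⟨hsrc, e, hq.2.2⟩)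
      filter_upwards [(continuous_snd.continuousAt.comp hcont).eventually_ne hne] with q' hq' hm
      exact hq' hm.2.1
    · have hne : (base φ q).1 ≠ 0 := fun e =>
        hqp (eq_of_mem_strands hp.2.1 hp.2.2 ⟨hsrc, e, hq.2.2⟩ hq)
      filter_upwards [(continuous_fst.continuousAt.comp hcont).eventually_ne hne] with q' hq' hm
      exact hq' hm.2.1
  filter_upwards [h1, h2, hother, hψ'.eventually_not_isSimpleAt,
    hψ'.eventually_mem_strand] with q' a1 a2 a3 a4 a5
  constructor
  · intro hm
    obtain ⟨hm1, hm2⟩ := a4 hm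
    cases σ
    · exact (a2 hm1 hm2).resolve_right fun hu => a3 hu.2
    · exact ((a2 hm1 hm2).resolve_left a3).2
  · intro hm
    obtain ⟨hm1, hm2⟩ := a1 hm
    exact (a5 hm1 hm2).resolve_right fun hu => hu.1.not_isBranchModel hψ

end Models

/-! ### Strands at double points do not depend on the chart -/

section Double

variable {M : Type*} [TopologicalSpace M] [ChartedSpace E3 M]
  {X : ∀ p : M, TangentSpace (𝓡 3) p} {B : Set M} {p : M}

/-- Another sheet above a point of the middle sheet is seen in every flow box. -/
theorem IsGapChart.eventually_β_pos [IsManifold (𝓡 3) ∞ M]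
    {φ Φ : OpenPartialHomeomorph M E3} {W W' : Set M}
    {f₀ f₁ f₂ α β f₀' f₁' f₂' α' β' : ℝ × ℝ → ℝ} (h : IsGapChart X B φ W f₀ f₁ f₂ α β)
    (h' : IsGapChart X B Φ W' f₀' f₁' f₂' α' β') (hp : p ∈ W) (hp' : p ∈ W')
    (h1 : φ p 2 = f₁ (base φ p)) (hβ : β (base φ p) = 0) :
    ∀ᶠ q in 𝓝 p, φ q 2 = f₁ (base φ q) → 0 < β (base φ q) →
      Φ q 2 = f₁' (base Φ q) → 0 < β' (base Φ q) := by
  obtain ⟨V, hV, hVV⟩ := exists_below_iff h.flowBox h'.flowBox (h.subset hp) (h'.subset hp')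
  have e12 : f₂ (base φ p) = φ p 2 := h1 ▸ le_antisymm
    (not_lt.1 fun hlt => by have := (h.lt₁₂ p hp).1 hlt; linarith) (h.le₁₂ p hp)
  have hN := Filter.inter_mem hV (Filter.inter_mem (h.mem_nhds hp) (h'.mem_nhds hp'))
  filter_upwards [hN, (continuousAt_base (h.subset hp)).eventually
    (eventually_exists_lift (h.subset hp) h.cont₂ e12 hN)] with q hq hlift hq1 hqβ hq1'
  obtain ⟨r, ⟨hrV, hrW, hrW'⟩, -, hr1, hr2⟩ := hlift
  have hb : Below φ q r :=
    ⟨hr1.symm, by rw [hq1, hr2]; exact (h.lt₁₂ q hq.2.1).2 hqβ⟩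
  obtain ⟨hb1, hb2⟩ := (hVV q hq.1 r hrV).1 hb
  have hrB : r ∈ B := (h.mem_iff r hrW).2 (Or.inr (Or.inr (by rw [hr2, hr1])))
  have l01 := h'.le₀₁ r hrW'
  rw [← h'.lt₁₂ q hq.2.2, ← hq1', hb1]
  rw [hb1] at hq1'
  rcases (h'.mem_iff r hrW').1 hrB with e | e | e
  · linarith
  · linarith
  · rwa [← e]

/-- Another sheet below a point of the middle sheet is seen in every flow box. -/
theorem IsGapChart.eventually_α_pos [IsManifold (𝓡 3) ∞ M]
    {φ Φ : OpenPartialHomeomorph M E3} {W W' : Set M}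
    {f₀ f₁ f₂ α β f₀' f₁' f₂' α' β' : ℝ × ℝ → ℝ} (h : IsGapChart X B φ W f₀ f₁ f₂ α β)
    (h' : IsGapChart X B Φ W' f₀' f₁' f₂' α' β') (hp : p ∈ W) (hp' : p ∈ W')
    (h1 : φ p 2 = f₁ (base φ p)) (hα : α (base φ p) = 0) :
    ∀ᶠ q in 𝓝 p, φ q 2 = f₁ (base φ q) → 0 < α (base φ q) →
      Φ q 2 = f₁' (base Φ q) → 0 < α' (base Φ q) := by
  obtain ⟨V, hV, hVV⟩ := exists_below_iff h.flowBox h'.flowBox (h.subset hp) (h'.subset hp')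
  have e01 : f₀ (base φ p) = φ p 2 := h1 ▸ le_antisymm (h.le₀₁ p hp)
    (not_lt.1 fun hlt => by have := (h.lt₀₁ p hp).1 hlt; linarith)
  have hN := Filter.inter_mem hV (Filter.inter_mem (h.mem_nhds hp) (h'.mem_nhds hp'))
  filter_upwards [hN, (continuousAt_base (h.subset hp)).eventually
    (eventually_exists_lift (h.subset hp) h.cont₀ e01 hN)] with q hq hlift hq1 hqα hq1'
  obtain ⟨r, ⟨hrV, hrW, hrW'⟩, -, hr1, hr2⟩ := hlift
  have hb : Below φ r q :=
    ⟨hr1, by rw [hq1, hr2]; exact (h.lt₀₁ q hq.2.1).2 hqα⟩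
  obtain ⟨hb1, hb2⟩ := (hVV r hrV q hq.1).1 hb
  have hrB : r ∈ B := (h.mem_iff r hrW).2 (Or.inl (by rw [hr2, hr1]))
  have l12 := h'.le₁₂ r hrW'
  rw [← h'.lt₀₁ q hq.2.2, ← hq1', ← hb1]
  rw [← hb1] at hq1'
  rcases (h'.mem_iff r hrW').1 hrB with e | e | e
  · rwa [← e]
  · linarith
  · linarith

/-- The projection of coordinate space along the third axis. -/
noncomputable def baseL : E3 →L[ℝ] ℝ × ℝ :=
  (EuclideanSpace.proj (0 : Fin 3)).prod (EuclideanSpace.proj (1 : Fin 3))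

/-- A function of the first two coordinates of a flow box `Φ` whose differential does not vanish
has, read in another flow box `φ`, a differential that kills the vertical direction and
does not vanish either. -/
theorem IsFlowBox.exists_hasFDerivAt_comp_base [IsManifold (𝓡 3) ∞ M]
    {φ Φ : OpenPartialHomeomorph M E3} (hφ : IsFlowBox X φ) (hΦ : IsFlowBox X Φ)
    (hp : p ∈ φ.source) (hp' : p ∈ Φ.source) {g : ℝ × ℝ → ℝ} {L : ℝ × ℝ →L[ℝ] ℝ}
    (hg : HasFDerivAt g L (base Φ p)) (hL : L ≠ 0) :
    ∃ A : E3 →L[ℝ] ℝ, HasFDerivAt (fun v => g (base Φ (φ.symm v))) A (φ p) ∧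
      A (EuclideanSpace.single 2 1) = 0 ∧
      (A (EuclideanSpace.single 0 1) ≠ 0 ∨ A (EuclideanSpace.single 1 1) ≠ 0) := by
  obtain ⟨hd, r, -, hr⟩ := hφ.transition hΦ hp hp'
  obtain ⟨hd', -⟩ := hΦ.transition hφ hp' hp
  set T := fderiv ℝ (Φ ∘ φ.symm) (φ p) with hT
  set T' := fderiv ℝ (φ ∘ Φ.symm) (Φ p) with hT'
  have hTT' : T.comp T' = ContinuousLinearMap.id ℝ E3 := by
    have h1 : HasFDerivAt (Φ ∘ φ.symm) T ((φ ∘ Φ.symm) (Φ p)) := by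
      simpa [Φ.left_inv hp'] using hd.hasFDerivAt
    have h2 := h1.comp (Φ p) hd'.hasFDerivAt
    refine h2.unique ((hasFDerivAt_id (Φ p)).congr_of_eventuallyEq ?_)
    have hN : Φ.target ∩ Φ.symm ⁻¹' φ.source ∈ 𝓝 (Φ p) := by
      apply Filter.inter_mem (Φ.open_target.mem_nhds (Φ.map_source hp'))
      apply (Φ.continuousAt_symm (Φ.map_source hp')).preimage_mem_nhds
      rw [Φ.left_inv hp']
      exact φ.open_source.mem_nhds hp
    filter_upwards [hN] with v hv
    simp [φ.left_inv hv.2, Φ.right_inv hv.1]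
  have hA : HasFDerivAt (fun v => g (base Φ (φ.symm v))) (L.comp (baseL.comp T)) (φ p) := by
    have h1 : HasFDerivAt g L (baseL ((Φ ∘ φ.symm) (φ p))) := by
      have : baseL ((Φ ∘ φ.symm) (φ p)) = base Φ p := by
        simp only [Function.comp, φ.left_inv hp]; rfl
      rwa [this]
    exact h1.comp (φ p) (baseL.hasFDerivAt.comp (φ p) hd.hasFDerivAt)
  refine ⟨_, hA, ?_, ?_⟩
  · have hz : baseL (r • (EuclideanSpace.single 2 1 : E3)) = 0 := by
      simp [baseL]
    simp only [ContinuousLinearMap.comp_apply]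
    rw [hr, hz, map_zero]
  · by_contra! hne
    apply hL
    have hz : (L.comp (baseL.comp T)) (EuclideanSpace.single 2 1) = 0 := by
      have hz : baseL (r • (EuclideanSpace.single 2 1 : E3)) = 0 := by
        simp [baseL]
      simp only [ContinuousLinearMap.comp_apply]
      rw [hr, hz, map_zero]
    have hzero : ∀ v, (L.comp (baseL.comp T)) v = 0 := by
      intro v
      have hv : v = v 0 • (EuclideanSpace.single 0 1 : E3) + v 1 • EuclideanSpace.single 1 1 +
          v 2 • EuclideanSpace.single 2 1 := by
        ext i
        fin_cases i <;> simp
      rw [hv]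
      simp only [map_add, map_smul, hne.1, hne.2, hz, smul_zero, add_zero]
    ext1
    · ext
      have h1 := hzero (T' (EuclideanSpace.single 0 1))
      have h2 : T (T' (EuclideanSpace.single 0 1)) = EuclideanSpace.single 0 1 :=
        DFunLike.congr_fun hTT' _
      simp only [ContinuousLinearMap.comp_apply, h2] at h1
      simpa [baseL] using h1
    · ext
      have h1 := hzero (T' (EuclideanSpace.single 1 1))
      have h2 : T (T' (EuclideanSpace.single 1 1)) = EuclideanSpace.single 1 1 :=
        DFunLike.congr_fun hTT' _
      simp only [ContinuousLinearMap.comp_apply, h2] at h1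
      simpa [baseL] using h1

theorem hasDerivAt_axis {g : E3 → ℝ} {A : E3 →L[ℝ] ℝ} (hg : HasFDerivAt g A 0) (e : E3) :
    HasDerivAt (fun t : ℝ => g (t • e)) (A e) 0 := by
  have h1 : HasFDerivAt g A ((0 : ℝ) • e) := by rwa [zero_smul]
  have h2 : HasDerivAt (fun t : ℝ => t • e) e 0 := by
    simpa using (hasDerivAt_id (0 : ℝ)).smul_const e
  exact h1.comp_hasDerivAt 0 h2

theorem apply_eq_zero_of_eventually {g : E3 → ℝ} {A : E3 →L[ℝ] ℝ} (hg : HasFDerivAt g A 0)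
    (hg0 : g 0 = 0) {e : E3} (h : ∀ᶠ t in 𝓝[>] (0 : ℝ), g (t • e) = 0) : A e = 0 := by
  have h1 := (hasDerivAt_axis hg e).hasDerivWithinAt (s := Ioi 0)
  have h2 : HasDerivWithinAt (fun _ : ℝ => (0 : ℝ)) (A e) (Ioi 0) 0 :=
    h1.congr_of_eventuallyEq (h.mono fun t ht => ht.symm) (by simp [hg0])
  exact (uniqueDiffWithinAt_Ioi (0 : ℝ)).eq_deriv _ h2 (hasDerivWithinAt_const _ _ _)

/-- At a double point the half of the lower strand with another sheet above it, and the half of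
the upper strand with another sheet below it, are recognized from the order along the fibres; the
other halves follow since the strands are smooth and cross transversally. -/
theorem IsDoubleModel.eventually_strand [IsManifold (𝓡 3) ∞ M]
    {φ Φ : OpenPartialHomeomorph M E3} {W : Set M} {f₀ f₁ f₂ α β : ℝ × ℝ → ℝ}
    (hd : IsDoubleModel X B p φ) (h : IsGapChart X B Φ W f₀ f₁ f₂ α β) (hp : p ∈ W)
    (hα : α (base Φ p) = 0) (hβ : β (base Φ p) = 0) {Lα Lβ : ℝ × ℝ →L[ℝ] ℝ}
    (hαd : HasFDerivAt α Lα (base Φ p)) (hβd : HasFDerivAt β Lβ (base Φ p))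
    (hLα : Lα ≠ 0) (hLβ : Lβ ≠ 0) :
    ∀ᶠ q in 𝓝 p, (q ∈ lowerStrand φ → α (base Φ q) = 0) ∧
      (q ∈ upperStrand φ → β (base Φ q) = 0) := by
  have hp0 : φ p = 0 := hd.1.2.2
  have hps : p ∈ φ.source := hd.1.2.1
  have hs : φ.symm 0 = p := by rw [← hp0, φ.left_inv hps]
  obtain ⟨W', hp', a, b, h'⟩ := hd.exists_gapChart
  have hlo : IsLiftChart X B p false φ := Or.inr hd
  have hup : IsLiftChart X B p true φ := Or.inr hd
  -- On both strands near `p`, one of `α`, `β` vanishes and the height is that of the middle sheet.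
  have hmid : ∀ᶠ q in 𝓝 p, q ∈ lowerStrand φ ∨ q ∈ upperStrand φ →
      Φ q 2 = f₁ (base Φ q) ∧ (α (base Φ q) = 0 ∨ β (base Φ q) = 0) := by
    filter_upwards [hlo.eventually_not_isSimpleAt, hup.eventually_not_isSimpleAt,
      h.mem_nhds hp] with q h1 h2 hq hor
    have h3 : q ∈ B ∧ ¬ IsSimpleAt X B q := hor.elim h1 h2
    exact h.mid_of_not_isSimpleAt hq h3.1 h3.2
  have hposβ := h'.eventually_β_pos h hp' hp (by simp [hp0]) (by simp [base_eq_zero hp0])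
  have hposα := h'.eventually_α_pos h hp' hp (by simp [hp0]) (by simp [base_eq_zero hp0])
  have hsymm : Tendsto φ.symm (𝓝 0) (𝓝 p) := by
    have := φ.continuousAt_symm (φ.map_source hps)
    rw [hp0] at this
    simpa [ContinuousAt, hs] using this
  have htarget : ∀ᶠ v in 𝓝 (0 : E3), v ∈ φ.target :=
    φ.open_target.mem_nhds (hp0 ▸ φ.map_source hps)
  have haxis : ∀ e : E3, Tendsto (fun t : ℝ => t • e) (𝓝 0) (𝓝 0) := fun e => by
    have : Continuous fun t : ℝ => t • e := by fun_prop
    simpa using this.tendsto 0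
  set e₀ : E3 := EuclideanSpace.single 0 1 with he₀
  set e₁ : E3 := EuclideanSpace.single 1 1 with he₁
  obtain ⟨A, hA, -, hA'⟩ :=
    h'.flowBox.exists_hasFDerivAt_comp_base h.flowBox hps (h.subset hp) hαd hLα
  obtain ⟨C, hC, -, hC'⟩ :=
    h'.flowBox.exists_hasFDerivAt_comp_base h.flowBox hps (h.subset hp) hβd hLβ
  rw [hp0] at hA hC
  have hA1 : A e₁ = 0 := by
    apply apply_eq_zero_of_eventually hA (by rw [hs, hα])
    have hN := ((haxis e₁).eventually (htarget.and (hsymm.eventually (hmid.and hposβ))))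
    filter_upwards [nhdsWithin_le_nhds hN, self_mem_nhdsWithin] with t ht ht0
    obtain ⟨ht1, ht2, ht3⟩ := ht
    have hlow : φ.symm (t • e₁) ∈ lowerStrand φ :=
      ⟨φ.map_target ht1, by rw [φ.right_inv ht1]; simp [he₁], by rw [φ.right_inv ht1]; simp [he₁]⟩
    obtain ⟨hm, h0 | h0⟩ := ht2 (Or.inl hlow)
    · exact h0
    · exact absurd h0 (ht3 hlow.2.2 (by
        simp only [base]
        rw [φ.right_inv ht1]
        simpa [he₁] using ht0) hm).ne'
  have hC0 : C e₀ = 0 := by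
    apply apply_eq_zero_of_eventually hC (by rw [hs, hβ])
    have hN := ((haxis e₀).eventually (htarget.and (hsymm.eventually (hmid.and hposα))))
    filter_upwards [nhdsWithin_le_nhds hN, self_mem_nhdsWithin] with t ht ht0
    obtain ⟨ht1, ht2, ht3⟩ := ht
    have hupp : φ.symm (t • e₀) ∈ upperStrand φ :=
      ⟨φ.map_target ht1, by rw [φ.right_inv ht1]; simp [he₀], by rw [φ.right_inv ht1]; simp [he₀]⟩
    obtain ⟨hm, h0 | h0⟩ := ht2 (Or.inr hupp)
    · exact absurd h0 (ht3 hupp.2.2 (by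
        simp only [base]
        rw [φ.right_inv ht1]
        simpa [he₀] using ht0) hm).ne'
    · exact h0
  have hA0 : A e₀ ≠ 0 := hA'.resolve_right (not_not.2 hA1)
  have hC1 : C e₁ ≠ 0 := hC'.resolve_left (not_not.2 hC0)
  -- Hence `β` does not vanish on the lower strand off `p`, nor `α` on the upper one.
  have hβne := (hasDerivAt_axis hC e₁).eventually_ne hC1 (c := 0)
  have hαne := (hasDerivAt_axis hA e₀).eventually_ne hA0 (c := 0)
  rw [eventually_nhdsWithin_iff] at hβne hαne
  have hc : ∀ i : Fin 3, Tendsto (fun q => φ q i) (𝓝 p) (𝓝 0) := fun i => by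
    have : Tendsto (fun q => φ q i) (𝓝 p) (𝓝 (φ p i)) :=
      (EuclideanSpace.proj (𝕜 := ℝ) i).continuous.continuousAt.comp (φ.continuousAt hps)
    simpa [hp0] using this
  filter_upwards [hmid, (hc 1).eventually hβne, (hc 0).eventually hαne] with q hq hqβ hqα
  constructor
  · intro hql
    have hq1 : φ q = φ q 1 • e₁ := by
      ext i
      fin_cases i
      · simpa [he₁] using hql.2.1
      · simp [he₁]
      · simpa [he₁] using hql.2.2
    by_cases h0 : φ q 1 = 0
    · rwa [eq_of_mem_strands hps hp0 hql ⟨hql.1, h0, hql.2.2⟩]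
    · have hne := hqβ h0
      rw [← hq1, φ.left_inv hql.1] at hne
      exact (hq (Or.inl hql)).2.resolve_right hne
  · intro hqu
    have hq1 : φ q = φ q 0 • e₀ := by
      ext i
      fin_cases i
      · simp [he₀]
      · simpa [he₀] using hqu.2.1
      · simpa [he₀] using hqu.2.2
    by_cases h0 : φ q 0 = 0
    · rwa [eq_of_mem_strands hps hp0 ⟨hqu.1, h0, hqu.2.2⟩ hqu]
    · have hne := hqα h0
      rw [← hq1, φ.left_inv hqu.1] at hne
      exact (hq (Or.inr hqu)).2.resolve_left hne

/-- The germ of a strand does not depend on the chart. -/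
theorem IsLiftChart.eventually_strand_imp [IsManifold (𝓡 3) ∞ M] {σ : Bool}
    {φ ψ : OpenPartialHomeomorph M E3} (hφ : IsLiftChart X B p σ φ)
    (hψ : IsLiftChart X B p σ ψ) : ∀ᶠ q in 𝓝 p, q ∈ strand φ σ → q ∈ strand ψ σ := by
  rcases hφ with ⟨rfl, hφ⟩ | hφ
  · have hφ' : IsLiftChart X B p false φ := Or.inl ⟨rfl, hφ⟩
    filter_upwards [hφ'.eventually_not_isSimpleAt, hψ.eventually_mem_strand] with q h1 h2 hq
    exact (h2 (h1 hq).1 (h1 hq).2).resolve_right fun hu => hu.1.not_isBranchModel hφ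
  · rcases hψ with ⟨-, hψ⟩ | hψ
    · exact absurd hψ hφ.not_isBranchModel
    have hφ' : IsLiftChart X B p σ φ := Or.inr hφ
    obtain ⟨W, hp, a, b, h⟩ := hψ.exists_gapChart
    have h0 := base_eq_zero hψ.1.2.2
    have h1 := hφ.eventually_strand h hp (by simp [h0]) (by simp [h0])
      (hasFDerivAt_fst (𝕜 := ℝ)) (hasFDerivAt_snd (𝕜 := ℝ))
      (fun e => by simpa using DFunLike.congr_fun e ((1 : ℝ), (0 : ℝ)))
      (fun e => by simpa using DFunLike.congr_fun e ((0 : ℝ), (1 : ℝ)))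
    filter_upwards [h1, hφ'.eventually_not_isSimpleAt, h.mem_nhds hp] with q hq h2 hqW hqs
    obtain ⟨h3, h4⟩ := h2 hqs
    have h5 := (h.mid_of_not_isSimpleAt hqW h3 h4).1
    cases σ
    · exact ⟨h.subset hqW, hq.1 hqs, h5⟩
    · exact ⟨h.subset hqW, hq.2 hqs, h5⟩

end Double

/-! ### Smooth segments and the smooth curves of the singular locus -/

section Segments

variable {M : Type*} [TopologicalSpace M] [ChartedSpace E3 M]
  {X : ∀ p : M, TangentSpace (𝓡 3) p} {B : Set M}

/-- At the parameter `t`, the path `c` on `[0, 1]` runs in the smooth branch `σ` of the singular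
locus. -/
def Follows (X : ∀ p : M, TangentSpace (𝓡 3) p) (B : Set M) (c : ℝ → M) (t : ℝ) (σ : Bool) :
    Prop :=
  ∃ φ, IsLiftChart X B (c t) σ φ ∧ ∀ᶠ s in 𝓝[Icc 0 1] t, c s ∈ strand φ σ

theorem isSmoothSegment_iff {c : ℝ → M} : IsSmoothSegment X B c ↔
    ContinuousOn c (Icc 0 1) ∧ (∀ t ∈ Icc (0 : ℝ) 1, ∃ s ∈ 𝓝[Icc 0 1] t, InjOn c s) ∧
      ∀ t ∈ Icc (0 : ℝ) 1, ∃ σ, Follows X B c t σ := by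
  constructor
  · intro h
    refine ⟨h.1, h.2, fun t ht => ?_⟩
    obtain ⟨φ, h | h | h⟩ := h.3 t ht
    · exact ⟨false, φ, Or.inl ⟨rfl, h.1⟩, h.2⟩
    · exact ⟨false, φ, Or.inr h.1, h.2⟩
    · exact ⟨true, φ, Or.inr h.1, h.2⟩
  · rintro ⟨h1, h2, h3⟩
    refine ⟨h1, h2, fun t ht => ?_⟩
    obtain ⟨σ, φ, hφ, hs⟩ := h3 t ht
    refine ⟨φ, ?_⟩
    cases σ
    · rcases hφ with hφ | hφ
      · exact Or.inl ⟨hφ.2, hs⟩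
      · exact Or.inr (Or.inl ⟨hφ, hs⟩)
    · rcases hφ with hφ | hφ
      · exact absurd hφ.1 (by simp)
      · exact Or.inr (Or.inr ⟨hφ, hs⟩)

theorem IsSmoothSegment.exists_follows {c : ℝ → M} (h : IsSmoothSegment X B c) {t : ℝ}
    (ht : t ∈ Icc (0 : ℝ) 1) : ∃ σ, Follows X B c t σ :=
  (isSmoothSegment_iff.1 h).2.2 t ht

theorem IsSmoothSegment.eventually_ne {c : ℝ → M} (h : IsSmoothSegment X B c) {t : ℝ}
    (ht : t ∈ Icc (0 : ℝ) 1) : ∀ᶠ s in 𝓝[Icc 0 1] t, s ≠ t → c s ≠ c t := by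
  obtain ⟨S, hS, hinj⟩ := h.locallyInjective t ht
  filter_upwards [hS] with s hs hne he
  exact hne (hinj hs (mem_of_mem_nhdsWithin ht hS) he)

theorem frequently_ne_Icc {t : ℝ} (ht : t ∈ Icc (0 : ℝ) 1) :
    ∃ᶠ s in 𝓝[Icc (0 : ℝ) 1] t, s ≠ t := by
  have h : Preperfect (Icc (0 : ℝ) 1) :=
    isPreconnected_Icc.preperfect_of_nontrivial
      ⟨0, by simp, 1, by simp, by simp⟩
  have := (accPt_iff_frequently.1 (h t ht))
  rw [frequently_nhdsWithin_iff]
  exact this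

theorem frequently_lt_Icc {t : ℝ} (ht : t ∈ Icc (0 : ℝ) 1) (h0 : 0 < t) :
    ∃ᶠ s in 𝓝[Icc (0 : ℝ) 1] t, s < t := by
  have h1 : ∀ᶠ s in 𝓝[<] t, s ∈ Icc (0 : ℝ) 1 ∧ s < t := by
    filter_upwards [Ioo_mem_nhdsLT h0] with s hs
    exact ⟨⟨hs.1.le, hs.2.le.trans ht.2⟩, hs.2⟩
  rw [frequently_nhdsWithin_iff]
  exact (h1.frequently.filter_mono nhdsWithin_le_nhds).mono fun s hs => ⟨hs.2, hs.1⟩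

/-- Transfer to a path that agrees locally with a reparametrization. -/
theorem Follows.congr {c C : ℝ → M} {g : ℝ → ℝ} {t : ℝ} {σ : Bool} (ht : t ∈ Icc (0 : ℝ) 1)
    (h : Follows X B c (g t) σ) (hg : Tendsto g (𝓝[Icc 0 1] t) (𝓝[Icc 0 1] (g t)))
    (hC : ∀ᶠ s in 𝓝[Icc 0 1] t, C s = c (g s)) : Follows X B C t σ := by
  obtain ⟨φ, hφ, hs⟩ := h
  have he : C t = c (g t) := hC.self_of_nhdsWithin ht
  refine ⟨φ, he ▸ hφ, ?_⟩
  filter_upwards [hC, hg.eventually hs] with s h1 h2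
  rwa [h1]

theorem tendsto_of_mapsTo_Icc {g : ℝ → ℝ} (hg : Continuous g)
    (hm : MapsTo g (Icc 0 1) (Icc 0 1)) (t : ℝ) :
    Tendsto g (𝓝[Icc 0 1] t) (𝓝[Icc 0 1] (g t)) :=
  (hg.continuousWithinAt (s := Icc 0 1) (x := t)).tendsto_nhdsWithin hm

theorem Follows.comp {c : ℝ → M} {g : ℝ → ℝ} (hg : Continuous g)
    (hm : MapsTo g (Icc 0 1) (Icc 0 1)) {t : ℝ} (ht : t ∈ Icc (0 : ℝ) 1) {σ : Bool}
    (h : Follows X B c (g t) σ) : Follows X B (c ∘ g) t σ :=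
  h.congr ht (tendsto_of_mapsTo_Icc hg hm t) (Eventually.of_forall fun _ => rfl)

theorem IsSmoothSegment.comp {c : ℝ → M} (h : IsSmoothSegment X B c) {g : ℝ → ℝ}
    (hg : Continuous g) (hi : Function.Injective g) (hm : MapsTo g (Icc 0 1) (Icc 0 1)) :
    IsSmoothSegment X B (c ∘ g) := by
  rw [isSmoothSegment_iff]
  refine ⟨h.continuousOn.comp hg.continuousOn hm, fun t ht => ?_, fun t ht => ?_⟩
  · obtain ⟨S, hS, hinj⟩ := h.locallyInjective (g t) (hm ht)
    exact ⟨g ⁻¹' S, tendsto_of_mapsTo_Icc hg hm t hS, hinj.comp hi.injOn fun s hs => hs⟩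
  · obtain ⟨σ, hσ⟩ := h.exists_follows (hm ht)
    exact ⟨σ, hσ.comp hg hm ht⟩

/-- Different branches through a double point meet only there. -/
theorem IsLiftChart.eventually_eq_of_ne [IsManifold (𝓡 3) ∞ M] {p : M} {σ τ : Bool}
    {φ ψ : OpenPartialHomeomorph M E3} (hφ : IsLiftChart X B p σ φ) (hψ : IsLiftChart X B p τ ψ)
    (hne : σ ≠ τ) : ∀ᶠ q in 𝓝 p, q ∈ strand φ σ → q ∈ strand ψ τ → q = p := by
  have key : ∀ {φ ψ : OpenPartialHomeomorph M E3}, IsLiftChart X B p false φ →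
      IsLiftChart X B p true ψ →
      ∀ᶠ q in 𝓝 p, q ∈ strand φ false → q ∈ strand ψ true → q = p := by
    intro φ ψ hφ hψ
    have hψ' : IsLiftChart X B p false ψ := Or.inr (hψ.resolve_left (by simp))
    filter_upwards [hφ.eventually_strand_imp hψ'] with q h1 h2 h3
    exact eq_of_mem_strands hψ.flowBoxAt.2.1 hψ.flowBoxAt.2.2 (h1 h2) h3
  cases σ <;> cases τ
  · exact absurd rfl hne
  · exact key hφ hψ
  · filter_upwards [key hψ hφ] with q hq h1 h2 using hq h2 h1
  · exact absurd rfl hne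

theorem IsSmoothSegment.follows_unique [IsManifold (𝓡 3) ∞ M] {c : ℝ → M}
    (h : IsSmoothSegment X B c) {t : ℝ} (ht : t ∈ Icc (0 : ℝ) 1) {σ τ : Bool}
    (hσ : Follows X B c t σ) (hτ : Follows X B c t τ) : σ = τ := by
  by_contra hne
  obtain ⟨φ, hφ, h1⟩ := hσ
  obtain ⟨ψ, hψ, h2⟩ := hτ
  obtain ⟨s, hs, h3, h4, h5, h6⟩ := ((frequently_ne_Icc ht).and_eventually
    (h1.and (h2.and ((h.eventually_ne ht).and
      ((h.continuousOn t ht).eventually (hφ.eventually_eq_of_ne hψ hne)))))).exists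
  exact h5 hs (h6 h3 h4)

theorem Follows.eventually_isBranchModel [IsManifold (𝓡 3) ∞ M] {c : ℝ → M}
    (hB : IsBranchedSurface X B) (h : IsSmoothSegment X B c) {t : ℝ} (ht : t ∈ Icc (0 : ℝ) 1)
    {σ : Bool} (hσ : Follows X B c t σ) :
    ∀ᶠ s in 𝓝[Icc 0 1] t, s ≠ t → ∃ ψ, IsBranchModel X B (c s) ψ := by
  obtain ⟨φ, hφ, h1⟩ := hσ
  filter_upwards [h1, h.eventually_ne ht, (h.continuousOn t ht).eventually
    (hφ.eventually_exists_isBranchModel hB)] with s h2 h3 h4 hs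
  exact h4 h2 (h3 hs)

/-- The pairs `u` and `v` (see `IsLiftChart`) are joined by a smooth segment. -/
def IsJoined (X : ∀ p : M, TangentSpace (𝓡 3) p) (B : Set M) (u v : M × Bool) : Prop :=
  ∃ c, IsSmoothSegment X B c ∧ c 0 = u.1 ∧ c 1 = v.1 ∧ Follows X B c 0 u.2 ∧ Follows X B c 1 v.2

/-- Two segments can be concatenated if the second does not backtrack along the first. -/
theorem IsSmoothSegment.isJoined_concat [IsManifold (𝓡 3) ∞ M] {c c' : ℝ → M}
    (hc : IsSmoothSegment X B c) (hc' : IsSmoothSegment X B c') (he : c 1 = c' 0) {σ : Bool}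
    (hσ : Follows X B c 1 σ) (hσ' : Follows X B c' 0 σ)
    (hdisj : ∀ᶠ s in 𝓝[Icc 0 1] (1 : ℝ), s < 1 → c s ∉ c' '' Icc 0 1) {u v : M × Bool}
    (hu : c 0 = u.1) (hu' : Follows X B c 0 u.2) (hv : c' 1 = v.1) (hv' : Follows X B c' 1 v.2) :
    IsJoined X B u v := by
  set C : ℝ → M := fun t => if t ≤ 1 / 2 then c (2 * t) else c' (2 * t - 1) with hCdef
  have hC1 : ∀ t ≤ (1 / 2 : ℝ), C t = c (2 * t) := fun t ht => if_pos ht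
  have hC2 : ∀ t ≥ (1 / 2 : ℝ), C t = c' (2 * t - 1) := by
    intro t ht
    rcases ht.eq_or_lt with h | h
    · rw [hC1 t h.symm.le, ← h]
      norm_num [he]
    · exact if_neg (not_le.2 h)
  -- The two halves, as reparametrizations near each parameter.
  have t1 : ∀ t : ℝ, t < 1 / 2 →
      Tendsto (fun t : ℝ => 2 * t) (𝓝[Icc 0 1] t) (𝓝[Icc 0 1] (2 * t)) := by
    intro t ht
    refine tendsto_nhdsWithin_iff.2 ⟨?_, ?_⟩
    · exact ((by fun_prop : Continuous fun t : ℝ => 2 * t).tendsto t).mono_left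
        nhdsWithin_le_nhds
    · filter_upwards [self_mem_nhdsWithin, nhdsWithin_le_nhds (Iio_mem_nhds ht)] with s hs hs'
      have : s < 1 / 2 := hs'
      exact ⟨by linarith [hs.1], by linarith⟩
  have e1 : ∀ t : ℝ, t < 1 / 2 → ∀ᶠ s in 𝓝[Icc 0 1] t, C s = c (2 * s) := by
    intro t ht
    filter_upwards [nhdsWithin_le_nhds (Iio_mem_nhds ht)] with s hs
    exact hC1 s (le_of_lt hs)
  have t2 : ∀ t : ℝ, 1 / 2 < t →
      Tendsto (fun t : ℝ => 2 * t - 1) (𝓝[Icc 0 1] t) (𝓝[Icc 0 1] (2 * t - 1)) := by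
    intro t ht
    refine tendsto_nhdsWithin_iff.2 ⟨?_, ?_⟩
    · exact ((by fun_prop : Continuous fun t : ℝ => 2 * t - 1).tendsto t).mono_left
        nhdsWithin_le_nhds
    · filter_upwards [self_mem_nhdsWithin, nhdsWithin_le_nhds (Ioi_mem_nhds ht)] with s hs hs'
      have : 1 / 2 < s := hs'
      exact ⟨by linarith, by linarith [hs.2]⟩
  have e2 : ∀ t : ℝ, 1 / 2 < t → ∀ᶠ s in 𝓝[Icc 0 1] t, C s = c' (2 * s - 1) := by
    intro t ht
    filter_upwards [nhdsWithin_le_nhds (Ioi_mem_nhds ht)] with s hs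
    exact hC2 s (le_of_lt hs)
  -- What holds near the end of `c` and near the start of `c'` holds near the junction.
  have h12 : ∀ {P Q : ℝ → Prop}, (∀ᶠ s in 𝓝[Icc 0 1] (1 : ℝ), P s) →
      (∀ᶠ s in 𝓝[Icc 0 1] (0 : ℝ), Q s) →
      ∀ᶠ s in 𝓝[Icc 0 1] (1 / 2 : ℝ), (s ≤ 1 / 2 → P (2 * s)) ∧ (1 / 2 ≤ s → Q (2 * s - 1)) := by
    intro P Q hP hQ
    rw [eventually_nhdsWithin_iff] at hP hQ ⊢
    have a1 : Tendsto (fun t : ℝ => 2 * t) (𝓝 (1 / 2)) (𝓝 1) := by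
      simpa using (by fun_prop : Continuous fun t : ℝ => 2 * t).tendsto (1 / 2)
    have a2 : Tendsto (fun t : ℝ => 2 * t - 1) (𝓝 (1 / 2)) (𝓝 0) := by
      simpa using (by fun_prop : Continuous fun t : ℝ => 2 * t - 1).tendsto (1 / 2)
    filter_upwards [a1.eventually hP, a2.eventually hQ] with s b1 b2 hs
    exact ⟨fun h => b1 ⟨by linarith [hs.1], by linarith⟩,
      fun h => b2 ⟨by linarith, by linarith [hs.2]⟩⟩
  have hC12 : C (1 / 2) = c 1 := by rw [hC1 _ le_rfl]; norm_num
  refine ⟨C, isSmoothSegment_iff.2 ⟨?_, ?_, ?_⟩, ?_, ?_, ?_, ?_⟩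
  · have hcl : Icc (0 : ℝ) 1 = Icc 0 (1 / 2) ∪ Icc (1 / 2) 1 :=
      (Icc_union_Icc_eq_Icc (by norm_num) (by norm_num)).symm
    rw [hcl]
    apply ContinuousOn.union_of_isClosed _ _ isClosed_Icc isClosed_Icc
    · refine ContinuousOn.congr (f := fun t => c (2 * t)) ?_ fun t ht => hC1 t ht.2
      exact hc.continuousOn.comp (by fun_prop)
        fun t ht => ⟨by linarith [ht.1], by linarith [ht.2]⟩
    · refine ContinuousOn.congr (f := fun t => c' (2 * t - 1)) ?_ fun t ht => hC2 t ht.1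
      exact hc'.continuousOn.comp (by fun_prop)
        fun t ht => ⟨by linarith [ht.1], by linarith [ht.2]⟩
  · intro t ht
    rcases lt_trichotomy t (1 / 2) with h | h | h
    · obtain ⟨S, hS, hi⟩ := hc.locallyInjective (2 * t) ⟨by linarith [ht.1], by linarith⟩
      refine ⟨_, Filter.inter_mem (t1 t h hS) (e1 t h), ?_⟩
      rintro s ⟨hs, hs'⟩ r ⟨hr, hr'⟩ hsr
      have hs'' : C s = c (2 * s) := hs'
      have hr'' : C r = c (2 * r) := hr'
      rw [hs'', hr''] at hsr
      linarith [hi hs hr hsr]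
    · subst h
      obtain ⟨S, hS, hi⟩ := hc.locallyInjective 1 (by simp)
      obtain ⟨S', hS', hi'⟩ := hc'.locallyInjective 0 (by simp)
      refine ⟨_, Filter.inter_mem (h12 (Filter.inter_mem hS hdisj) hS') self_mem_nhdsWithin, ?_⟩
      have cross : ∀ s r : ℝ, s ≤ 1 / 2 → 1 / 2 < r → r ∈ Icc (0 : ℝ) 1 →
          (2 * s < 1 → c (2 * s) ∉ c' '' Icc 0 1) → 2 * r - 1 ∈ S' → C s ≠ C r := by
        intro s r hs hr hr1 hsd hrS hsr
        rw [hC1 s hs, hC2 r hr.le] at hsr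
        rcases hs.eq_or_lt with h | h
        · rw [h, show (2 : ℝ) * (1 / 2) = 1 by norm_num, he] at hsr
          linarith [hi' (mem_of_mem_nhdsWithin (by simp) hS') hrS hsr]
        · exact hsd (by linarith) ⟨_, ⟨by linarith, by linarith [hr1.2]⟩, hsr.symm⟩
      rintro s ⟨⟨hs1, hs2⟩, hsI⟩ r ⟨⟨hr1, hr2⟩, hrI⟩ hsr
      rcases le_or_gt s (1 / 2) with hs | hs <;> rcases le_or_gt r (1 / 2) with hr | hr
      · rw [hC1 s hs, hC1 r hr] at hsr
        linarith [hi (hs1 hs).1 (hr1 hr).1 hsr]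
      · exact absurd hsr (cross s r hs hr hrI (hs1 hs).2 (hr2 hr.le))
      · exact absurd hsr.symm (cross r s hr hs hsI (hr1 hr).2 (hs2 hs.le))
      · rw [hC2 s hs.le, hC2 r hr.le] at hsr
        linarith [hi' (hs2 hs.le) (hr2 hr.le) hsr]
    · obtain ⟨S, hS, hi⟩ := hc'.locallyInjective (2 * t - 1) ⟨by linarith, by linarith [ht.2]⟩
      refine ⟨_, Filter.inter_mem (t2 t h hS) (e2 t h), ?_⟩
      rintro s ⟨hs, hs'⟩ r ⟨hr, hr'⟩ hsr
      have hs'' : C s = c' (2 * s - 1) := hs'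
      have hr'' : C r = c' (2 * r - 1) := hr'
      rw [hs'', hr''] at hsr
      linarith [hi hs hr hsr]
  · intro t ht
    rcases lt_trichotomy t (1 / 2) with h | h | h
    · obtain ⟨τ, hτ⟩ := hc.exists_follows (t := 2 * t) ⟨by linarith [ht.1], by linarith⟩
      exact ⟨τ, Follows.congr (g := fun t => 2 * t) ht hτ (t1 t h) (e1 t h)⟩
    · subst h
      obtain ⟨φ, hφ, h1⟩ := hσ
      obtain ⟨ψ, hψ, h2⟩ := hσ'
      have hφ' := hφ
      rw [he] at hφ'
      have h3 : ∀ᶠ s in 𝓝[Icc 0 1] (0 : ℝ), c' s ∈ strand φ σ := by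
        filter_upwards [h2, (hc'.continuousOn 0 (by simp)).eventually
          (hψ.eventually_strand_imp hφ')] with s a1 a2 using a2 a1
      refine ⟨σ, φ, hC12 ▸ hφ, ?_⟩
      filter_upwards [h12 h1 h3] with s hs
      rcases le_total s (1 / 2) with h | h
      · rw [hC1 s h]; exact hs.1 h
      · rw [hC2 s h]; exact hs.2 h
    · obtain ⟨τ, hτ⟩ := hc'.exists_follows (t := 2 * t - 1) ⟨by linarith, by linarith [ht.2]⟩
      exact ⟨τ, Follows.congr (g := fun t => 2 * t - 1) ht hτ (t2 t h) (e2 t h)⟩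
  · rw [hC1 0 (by norm_num), mul_zero, hu]
  · rw [hC2 1 (by norm_num)]
    norm_num [hv]
  · exact Follows.congr (g := fun t => 2 * t) (by simp) (by simpa using hu')
      (t1 0 (by norm_num)) (e1 0 (by norm_num))
  · refine Follows.congr (c := c') (g := fun t => 2 * t - 1) (by simp) ?_
      (t2 1 (by norm_num)) (e2 1 (by norm_num))
    norm_num
    exact hv'

/-- An embedded smooth segment `A`, with its branches `ℓ`, whose interior is open in the smooth
curve of the singular locus that contains it. -/
structure IsArc (X : ∀ p : M, TangentSpace (𝓡 3) p) (B : Set M) (A : ℝ → M) (ℓ : ℝ → Bool) :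
    Prop where
  continuousOn : ContinuousOn A (Icc 0 1)
  injOn : InjOn A (Icc 0 1)
  follows : ∀ t ∈ Icc (0 : ℝ) 1, Follows X B A t (ℓ t)
  isOpen : ∀ t ∈ Ioo (0 : ℝ) 1, ∀ ψ, IsLiftChart X B (A t) (ℓ t) ψ →
    ∀ᶠ q in 𝓝 (A t), q ∈ strand ψ (ℓ t) → q ∈ A '' Icc 0 1

theorem IsArc.isSmoothSegment {A : ℝ → M} {ℓ : ℝ → Bool} (h : IsArc X B A ℓ) :
    IsSmoothSegment X B A :=
  isSmoothSegment_iff.2 ⟨h.continuousOn, fun _ _ => ⟨_, self_mem_nhdsWithin, h.injOn⟩,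
    fun t ht => ⟨_, h.follows t ht⟩⟩

theorem IsArc.reverse {A : ℝ → M} {ℓ : ℝ → Bool} (h : IsArc X B A ℓ) :
    IsArc X B (A ∘ fun t => 1 - t) (ℓ ∘ fun t => 1 - t) := by
  have hg : Continuous fun t : ℝ => 1 - t := by fun_prop
  have hm : MapsTo (fun t : ℝ => 1 - t) (Icc 0 1) (Icc 0 1) :=
    fun t ht => ⟨by linarith [ht.2], by linarith [ht.1]⟩
  refine ⟨h.continuousOn.comp hg.continuousOn hm, h.injOn.comp (sub_right_injective).injOn hm,
    fun t ht => (h.follows _ (hm ht)).comp hg hm ht, fun t ht ψ hψ => ?_⟩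
  filter_upwards [h.isOpen (1 - t) ⟨by linarith [ht.2], by linarith [ht.1]⟩ ψ hψ] with q hq hqs
  obtain ⟨s, hs, rfl⟩ := hq hqs
  exact ⟨1 - s, hm hs, by simp⟩

/-- A continuous injective map on a compact set is an embedding, in terms of filters. -/
theorem eventually_mem_image_imp {Y : Type*} [TopologicalSpace Y] [T2Space Y] {A : ℝ → Y}
    {K : Set ℝ} (hK : IsCompact K) (hA : ContinuousOn A K) (hi : InjOn A K) {s : ℝ} (hs : s ∈ K)
    {P : Y → Prop} (h : ∀ᶠ r in 𝓝[K] s, P (A r)) : ∀ᶠ q in 𝓝 (A s), q ∈ A '' K → P q := by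
  obtain ⟨U, hU, hsU, hUP⟩ := mem_nhdsWithin.1 h
  have hc : IsCompact (A '' (K \ U)) :=
    (hK.diff hU).image_of_continuousOn (hA.mono sdiff_subset)
  have hn : A s ∉ A '' (K \ U) := by
    rintro ⟨r, hr, hrs⟩
    exact hr.2 (hi hr.1 hs hrs ▸ hsU)
  filter_upwards [hc.isClosed.isOpen_compl.mem_nhds hn] with q hq hqK
  obtain ⟨r, hr, rfl⟩ := hqK
  by_cases hrU : r ∈ U
  · exact hUP ⟨hrU, hr⟩
  · exact absurd ⟨r, ⟨hr, hrU⟩, rfl⟩ hq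

/-- What is joined to one end of an arc is joined to the other end, without backtracking: cut the
given segment at its first point on the arc.  This point is an end of the arc, or the start of the
segment, since the interior of the arc is open. -/
theorem IsArc.isJoined [T2Space M] [IsManifold (𝓡 3) ∞ M] (hB : IsBranchedSurface X B)
    {A : ℝ → M} {ℓ : ℝ → Bool} (hA : IsArc X B A ℓ) {u : M × Bool}
    (hu : u = (A 0, ℓ 0) ∨ IsJoined X B u (A 0, ℓ 0)) :
    u = (A 1, ℓ 1) ∨ IsJoined X B u (A 1, ℓ 1) := by
  rcases hu with rfl | ⟨c, hc, hc0, hc1, hcu, hcv⟩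
  · exact Or.inr ⟨A, hA.isSmoothSegment, rfl, rfl, hA.follows 0 (by simp),
      hA.follows 1 (by simp)⟩
  have hAs := hA.isSmoothSegment
  set T : Set ℝ := {t | t ∈ Icc (0 : ℝ) 1 ∧ ∃ s ∈ Icc (0 : ℝ) 1, c t = A s ∧
    Follows X B c t (ℓ s)} with hT
  have h1T : (1 : ℝ) ∈ T := ⟨by simp, 0, by simp, hc1, hcv⟩
  have hTb : BddBelow T := ⟨0, fun t ht => ht.1.1⟩
  have hclosed : ∀ t ∈ Icc (0 : ℝ) 1, t ∉ T → ∀ᶠ s in 𝓝[Icc 0 1] t, s ∉ T := by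
    intro t ht htT
    by_cases hmem : c t ∈ A '' Icc 0 1
    · obtain ⟨s, hs, hst⟩ := hmem
      obtain ⟨σ, hσ⟩ := hc.exists_follows ht
      have hne : σ ≠ ℓ s := by
        rintro rfl
        exact htT ⟨ht, s, hs, hst.symm, hσ⟩
      obtain ⟨ψ, hψ, h1⟩ := hσ
      obtain ⟨φ, hφ, h2⟩ := hA.follows s hs
      have h3 := eventually_mem_image_imp isCompact_Icc hA.continuousOn hA.injOn hs h2
      rw [hst] at h3 hφ
      filter_upwards [h1, hc.eventually_ne ht, (hc.continuousOn t ht).eventually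
        (h3.and (hψ.eventually_eq_of_ne hφ hne))] with r a1 a2 a3 hr
      by_cases hrt : r = t
      · exact htT (hrt ▸ hr)
      · obtain ⟨-, s', hs', hrs', -⟩ := hr
        exact a2 hrt (a3.2 a1 (a3.1 ⟨s', hs', hrs'.symm⟩))
    · have hcl := (isCompact_Icc.image_of_continuousOn hA.continuousOn).isClosed
      filter_upwards [(hc.continuousOn t ht).eventually (hcl.isOpen_compl.mem_nhds hmem)]
        with r hr hrT
      obtain ⟨-, s', hs', hrs', -⟩ := hrT
      exact hr ⟨s', hs', hrs'.symm⟩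
  set t₀ := sInf T with ht₀
  have ht0 : t₀ ∈ Icc (0 : ℝ) 1 :=
    ⟨le_csInf ⟨1, h1T⟩ fun t ht => ht.1.1, csInf_le hTb h1T⟩
  have hmin : ∀ t, t < t₀ → t ∉ T := fun t ht htT => not_le.2 ht (csInf_le hTb htT)
  have ht0T : t₀ ∈ T := by
    by_contra hn
    have h1 := hclosed t₀ ht0 hn
    have h2 := (isGLB_csInf ⟨1, h1T⟩ hTb).frequently_mem ⟨1, h1T⟩
    rw [eventually_nhdsWithin_iff] at h1
    obtain ⟨t, h3, h4⟩ := ((h2.filter_mono nhdsWithin_le_nhds).and_eventually h1).exists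
    exact h4 h3.1 h3
  obtain ⟨-, s₀, hs0, hcs, hfol⟩ := ht0T
  rcases ht0.1.eq_or_lt with h0 | h0
  · rw [← h0] at hcs hfol
    have hus : u = (A s₀, ℓ s₀) :=
      Prod.ext (hc0.symm.trans hcs) (hc.follows_unique (by simp) hcu hfol)
    rcases hs0.2.eq_or_lt with h1 | h1
    · left
      rw [hus, h1]
    · right
      have hg : Continuous fun t : ℝ => s₀ + (1 - s₀) * t := by fun_prop
      have hi : Function.Injective fun t : ℝ => s₀ + (1 - s₀) * t := fun a b hab =>
        mul_left_cancel₀ (sub_pos.2 h1).ne' (add_left_cancel hab)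
      have hm : MapsTo (fun t : ℝ => s₀ + (1 - s₀) * t) (Icc 0 1) (Icc 0 1) := fun t ht =>
        ⟨add_nonneg hs0.1 (mul_nonneg (sub_pos.2 h1).le ht.1), by
          nlinarith [mul_le_mul_of_nonneg_left ht.2 (sub_pos.2 h1).le]⟩
      refine ⟨_, hAs.comp hg hi hm, by simp [hus], by simp, ?_, ?_⟩
      · refine Follows.comp hg hm (by simp) ?_
        simpa [hus] using hA.follows s₀ hs0
      · refine Follows.comp hg hm (by simp) ?_
        simpa using hA.follows 1 (by simp)
  · have hP : ∀ᶠ s in 𝓝[Icc 0 1] t₀, s < t₀ → c s ∉ A '' Icc 0 1 := by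
      filter_upwards [hfol.eventually_isBranchModel hB hc ht0, self_mem_nhdsWithin]
        with s h1 hsI hs
      rintro ⟨r, hr, hrs⟩
      obtain ⟨ψ, hψ⟩ := h1 hs.ne
      have hlab : ∀ τ χ, IsLiftChart X B (c s) τ χ → τ = false := by
        intro τ χ h
        cases τ
        · rfl
        · exact absurd h hψ.not_isLiftChart_true
      obtain ⟨τ, hτ⟩ := hc.exists_follows hsI
      obtain ⟨χ, hχ, -⟩ := hA.follows r hr
      rw [hrs] at hχ
      refine hmin s hs ⟨hsI, r, hr, hrs.symm, ?_⟩
      rw [hlab _ _ hχ, ← hlab _ _ hτ.choose_spec.1]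
      exact hτ
    have hg : Continuous fun t : ℝ => t₀ * t := by fun_prop
    have hi : Function.Injective fun t : ℝ => t₀ * t := fun a b hab =>
      mul_left_cancel₀ h0.ne' hab
    have hm : MapsTo (fun t : ℝ => t₀ * t) (Icc 0 1) (Icc 0 1) := fun t ht =>
      ⟨mul_nonneg h0.le ht.1, mul_le_one₀ ht0.2 ht.1 ht.2⟩
    have hcseg := hc.comp hg hi hm
    have hstart : Follows X B (c ∘ fun t => t₀ * t) 0 u.2 :=
      Follows.comp hg hm (by simp) (by simpa using hcu)
    have hend : Follows X B (c ∘ fun t => t₀ * t) 1 (ℓ s₀) :=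
      Follows.comp hg hm (by simp) (by simpa using hfol)
    rcases hs0.1.eq_or_lt with hs | hs
    · right
      rw [← hs] at hcs hend
      refine hcseg.isJoined_concat hAs (by simpa using hcs) hend (hA.follows 0 (by simp)) ?_
        (by simpa using hc0) hstart rfl (hA.follows 1 (by simp))
      have ht : Tendsto (fun t : ℝ => t₀ * t) (𝓝[Icc 0 1] 1) (𝓝[Icc 0 1] t₀) := by
        simpa using tendsto_of_mapsTo_Icc hg hm 1
      filter_upwards [ht.eventually hP] with s h1 h2
      exact h1 (by nlinarith)
    rcases hs0.2.eq_or_lt with hs1 | hs1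
    · right
      rw [hs1] at hcs hend
      exact ⟨_, hcseg, by simpa using hc0, by simpa using hcs, hstart, hend⟩
    · exfalso
      obtain ⟨ψ, hψ, hψs⟩ := hfol
      have hop := hA.isOpen s₀ ⟨hs, hs1⟩
      rw [← hcs] at hop
      obtain ⟨s, h1, h2, h3, h4⟩ := ((frequently_lt_Icc ht0 h0).and_eventually
        (hP.and (hψs.and ((hc.continuousOn t₀ ht0).eventually (hop ψ hψ))))).exists
      exact h2 h1 (h4 h3)

end Segments

/-! ### Twisted curves as cycles of smooth curves -/

section Curves

variable {M : Type*} [TopologicalSpace M] [ChartedSpace E3 M]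
  {X : ∀ p : M, TangentSpace (𝓡 3) p} {B : Set M}

/-- The smooth curve of the singular locus through `v` (see `IsLiftChart`), as the set of the
pairs that are joined to `v` by a smooth segment. -/
def curveOf (X : ∀ p : M, TangentSpace (𝓡 3) p) (B : Set M) (v : M × Bool) : Set (M × Bool) :=
  {u | u = v ∨ IsJoined X B u v}

/-- The map `K` is constant along the smooth curves of the singular locus of `B`. -/
def IsCurveColoring (X : ∀ p : M, TangentSpace (𝓡 3) p) (B : Set M) {P : Type*}
    (K : M × Bool → P) : Prop :=
  ∀ p σ φ, IsLiftChart X B p σ φ →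
    ∀ᶠ q in 𝓝 p, q ∈ strand φ σ → q ≠ p → K (q, false) = K (p, σ)

/-- The direction of a strand in its chart. -/
def axis : Bool → Fin 3
  | false => 1
  | true => 0

omit [ChartedSpace E3 M] in
theorem mem_strand_iff {φ : OpenPartialHomeomorph M E3} {σ : Bool} {q : M} :
    q ∈ strand φ σ ↔ q ∈ φ.source ∧ ∀ j, j ≠ axis σ → φ q j = 0 := by
  cases σ
  · constructor
    · rintro ⟨h1, h2, h3⟩
      refine ⟨h1, fun j hj => ?_⟩
      fin_cases j
      exacts [h2, absurd rfl hj, h3]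
    · rintro ⟨h1, h2⟩
      exact ⟨h1, h2 0 (by simp [axis]), h2 2 (by simp [axis])⟩
  · constructor
    · rintro ⟨h1, h2, h3⟩
      refine ⟨h1, fun j hj => ?_⟩
      fin_cases j
      exacts [absurd rfl hj, h2, h3]
    · rintro ⟨h1, h2⟩
      exact ⟨h1, h2 1 (by simp [axis]), h2 2 (by simp [axis])⟩

/-- A short piece of a strand from the centre of its chart is an arc. -/
theorem IsLiftChart.eventually_exists_isArc [IsManifold (𝓡 3) ∞ M] (hB : IsBranchedSurface X B)
    {p : M} {σ : Bool} {φ : OpenPartialHomeomorph M E3} (h : IsLiftChart X B p σ φ) :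
    ∀ᶠ q in 𝓝 p, q ∈ strand φ σ → q ≠ p → ∃ A ℓ, IsArc X B A ℓ ∧
      A 0 = p ∧ ℓ 0 = σ ∧ A 1 = q ∧ ℓ 1 = false := by
  obtain ⟨-, hps, hp0⟩ := h.flowBoxAt
  have hsymm : Tendsto φ.symm (𝓝 0) (𝓝 p) := by
    have := φ.continuousAt_symm (φ.map_source hps)
    rw [ContinuousAt, φ.left_inv hps, hp0] at this
    exact this
  have htarget : ∀ᶠ v in 𝓝 (0 : E3), v ∈ φ.target :=
    φ.open_target.mem_nhds (hp0 ▸ φ.map_source hps)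
  obtain ⟨ε, hε, hball⟩ := Metric.eventually_nhds_iff_ball.1 (htarget.and (hsymm.eventually
    ((h.eventually_exists_isBranchModel hB).and h.eventually_lowerStrand_iff)))
  have hφb : ∀ᶠ q in 𝓝 p, φ q ∈ Metric.ball (0 : E3) ε :=
    (φ.continuousAt hps).eventually (hp0.symm ▸ Metric.ball_mem_nhds _ hε)
  filter_upwards [hφb] with q hqb hq hqp
  have hqs := (mem_strand_iff.1 hq).1
  have hq0 : φ q ≠ 0 := fun e => hqp (φ.injOn hqs hps (e.trans hp0.symm))
  have hqi : φ q (axis σ) ≠ 0 := by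
    intro e
    apply hq0
    ext j
    by_cases hj : j = axis σ
    · rw [hj]; exact e
    · exact (mem_strand_iff.1 hq).2 j hj
  have hin : ∀ t ∈ Icc (0 : ℝ) 1, t • φ q ∈ Metric.ball (0 : E3) ε := by
    intro t ht
    rw [mem_ball_zero_iff] at hqb ⊢
    rw [norm_smul, Real.norm_of_nonneg ht.1]
    exact (mul_le_of_le_one_left (norm_nonneg _) ht.2).trans_lt hqb
  have htgt : ∀ t ∈ Icc (0 : ℝ) 1, t • φ q ∈ φ.target := fun t ht => (hball _ (hin t ht)).1
  set A : ℝ → M := fun t => φ.symm (t • φ q) with hAdef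
  have hφA : ∀ t ∈ Icc (0 : ℝ) 1, φ (A t) = t • φ q := fun t ht => φ.right_inv (htgt t ht)
  have hA0 : A 0 = p := by
    simp only [hAdef]
    rw [zero_smul, ← hp0, φ.left_inv hps]
  have hA1 : A 1 = q := by
    simp only [hAdef]
    rw [one_smul, φ.left_inv hqs]
  have hAs : ∀ t ∈ Icc (0 : ℝ) 1, A t ∈ strand φ σ := by
    intro t ht
    refine mem_strand_iff.2 ⟨φ.map_target (htgt t ht), fun j hj => ?_⟩
    rw [hφA t ht]
    simp [(mem_strand_iff.1 hq).2 j hj]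
  have hAp : ∀ t ∈ Icc (0 : ℝ) 1, t ≠ 0 → A t ≠ p := by
    intro t ht ht0 he
    have := hφA t ht
    rw [he, hp0] at this
    exact (smul_ne_zero ht0 hq0) this.symm
  have hAc : ContinuousOn A (Icc 0 1) := by
    intro t ht
    have h1 : ContinuousAt φ.symm (t • φ q) := φ.continuousAt_symm (htgt t ht)
    have h2 : Continuous fun t : ℝ => t • φ q := by fun_prop
    exact (ContinuousAt.comp (f := fun t : ℝ => t • φ q) h1 h2.continuousAt).continuousWithinAt
  have hAall : ∀ t, ∀ᶠ s in 𝓝[Icc 0 1] t, A s ∈ strand φ σ := fun t =>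
    eventually_mem_nhdsWithin.mono hAs
  set ℓ : ℝ → Bool := fun t => if t = 0 then σ else false with hℓ
  refine ⟨A, ℓ, ⟨hAc, ?_, ?_, ?_⟩, hA0, by simp [hℓ], hA1, by simp [hℓ]⟩
  · intro s hs t ht hst
    have h1 := hφA s hs
    rw [hst, hφA t ht] at h1
    exact (smul_left_injective ℝ hq0 h1).symm
  · intro t ht
    by_cases ht0 : t = 0
    · subst ht0
      refine ⟨φ, ?_, ?_⟩
      · rw [hA0]; simpa [hℓ] using h
      · simpa [hℓ] using hAall 0
    · obtain ⟨-, hb1, hb2⟩ := hball _ (hin t ht)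
      obtain ⟨ψ, hψ⟩ := hb1 (hAs t ht) (hAp t ht ht0)
      refine ⟨ψ, Or.inl ⟨by simp [hℓ, ht0], hψ⟩, ?_⟩
      have hev := (hAc t ht).eventually (hb2 (hAs t ht) (hAp t ht ht0) ψ hψ)
      filter_upwards [hev, hAall t] with s h1 h2
      simp only [hℓ, ht0, if_false]
      exact h1.2 h2
  · intro t ht ψ hψ
    have ht' : t ∈ Icc (0 : ℝ) 1 := ⟨ht.1.le, ht.2.le⟩
    obtain ⟨-, hb1, hb2⟩ := hball _ (hin t ht')
    have hψ' : IsBranchModel X B (A t) ψ := by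
      obtain ⟨χ, hχ⟩ := hb1 (hAs t ht') (hAp t ht' ht.1.ne')
      rcases hψ with hψ | hψ
      · exact hψ.2
      · exact absurd hχ hψ.not_isBranchModel
    have hℓt : ℓ t = false := by simp [hℓ, ht.1.ne']
    have hr : ContinuousAt (fun q' => φ q' (axis σ) / φ q (axis σ)) (A t) := by
      have h1 := φ.continuousAt (φ.map_target (htgt t ht'))
      exact ((EuclideanSpace.proj (𝕜 := ℝ) (axis σ)).continuous.continuousAt.comp h1).div_const _
    have hrt : φ (A t) (axis σ) / φ q (axis σ) = t := by
      rw [hφA t ht']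
      simp [hqi]
    have hrI : ∀ᶠ q' in 𝓝 (A t), φ q' (axis σ) / φ q (axis σ) ∈ Ioo (0 : ℝ) 1 := by
      have h0 : Ioo (0 : ℝ) 1 ∈ 𝓝 (φ (A t) (axis σ) / φ q (axis σ)) :=
        hrt.symm ▸ Ioo_mem_nhds ht.1 ht.2
      exact hr h0
    filter_upwards [hb2 (hAs t ht') (hAp t ht' ht.1.ne') ψ hψ', hrI] with q' h1 h2 h3
    rw [hℓt] at h3
    have h4 := mem_strand_iff.1 (h1.1 h3)
    refine ⟨_, ⟨h2.1.le, h2.2.le⟩, ?_⟩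
    have h5 : (φ q' (axis σ) / φ q (axis σ)) • φ q = φ q' := by
      ext j
      by_cases hj : j = axis σ
      · rw [hj]
        simp [hqi]
      · simp [h4.2 j hj, (mem_strand_iff.1 hq).2 j hj]
    simp only [hAdef]
    rw [h5, φ.left_inv h4.1]

theorem isCurveColoring_curveOf [T2Space M] [IsManifold (𝓡 3) ∞ M]
    (hB : IsBranchedSurface X B) : IsCurveColoring X B (curveOf X B) := by
  intro p σ φ h
  filter_upwards [h.eventually_exists_isArc hB] with q hq hqs hqp
  obtain ⟨A, ℓ, hA, h1, h2, h3, h4⟩ := hq hqs hqp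
  ext u
  constructor
  · intro hu
    have := hA.reverse.isJoined hB (u := u)
    simp only [Function.comp, sub_zero, sub_self, h1, h2, h3, h4] at this
    exact this hu
  · intro hu
    have := hA.isJoined hB (u := u)
    simp only [h1, h2, h3, h4] at this
    exact this hu

/-- At some double point, the curve `y` is over the curve `x`. -/
def IsOver (X : ∀ p : M, TangentSpace (𝓡 3) p) (B : Set M) (x y : Set (M × Bool)) : Prop :=
  ∃ p φ, IsDoubleModel X B p φ ∧ curveOf X B (p, false) = x ∧ curveOf X B (p, true) = y

theorem exists_sequence_of_transGen {P : Type*} {r : P → P → Prop} {a b : P}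
    (h : Relation.TransGen r a b) :
    ∃ (n : ℕ) (f : ℕ → P), f 0 = a ∧ f (n + 1) = b ∧ ∀ i ≤ n, r (f i) (f (i + 1)) := by
  induction h with
  | @single b hab =>
    refine ⟨0, fun i => if i = 0 then a else b, by simp, by simp, fun i hi => ?_⟩
    obtain rfl : i = 0 := by omega
    simpa using hab
  | @tail b c _ hbc ih =>
    obtain ⟨n, f, h0, h1, h2⟩ := ih
    refine ⟨n + 1, fun i => if i ≤ n + 1 then f i else c, by simp [h0], by simp, fun i hi => ?_⟩
    rcases hi.eq_or_lt with h | h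
    · subst h
      simpa [h1] using hbc
    · have e1 : i ≤ n + 1 := by omega
      have e2 : i + 1 ≤ n + 1 := by omega
      simp only [if_pos e1, if_pos e2]
      exact h2 i (by omega)

/-- A cycle of curves, each over the preceding one, is traced by a positive twisted curve. -/
theorem hasTwistedCurve_of_transGen [IsManifold (𝓡 3) ∞ M] {x : Set (M × Bool)}
    (h : Relation.TransGen (IsOver X B) x x) : HasTwistedCurve X B := by
  obtain ⟨n, f, h0, h1, h2⟩ := exists_sequence_of_transGen h
  have h3 : ∀ i : Fin (n + 1), ∃ p φ, IsDoubleModel X B p φ ∧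
      curveOf X B (p, false) = f i ∧ curveOf X B (p, true) = f (i + 1) :=
    fun i => h2 i (Nat.lt_succ_iff.1 i.2)
  choose p φ hd hlo hup using h3
  have hwrap : ∀ i : Fin (n + 1), f ((i : ℕ) + 1) = f ((i + 1 : Fin (n + 1)) : ℕ) := by
    intro i
    rw [Fin.val_add_one]
    split_ifs with hi
    · rw [hi, Fin.val_last, h1, h0]
    · rfl
  have hj : ∀ i : Fin (n + 1), IsJoined X B (p i, true) (p (i + 1), false) := by
    intro i
    have he : (p i, true) ∈ curveOf X B (p (i + 1), false) := by
      rw [hlo (i + 1), ← hwrap i, ← hup i]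
      exact Or.inl rfl
    rcases he with he | he
    · exact absurd (congrArg Prod.snd he) (by simp)
    · exact he
  choose c hc hc0 hc1 hcu hcv using hj
  refine ⟨n, c, Or.inl ⟨hc, fun i => ⟨(hc1 i).trans (hc0 (i + 1)).symm, φ (i + 1), ?_, ?_, ?_⟩⟩⟩
  · rw [hc1 i]
    exact hd (i + 1)
  · obtain ⟨χ, hχ, hs⟩ := hcv i
    have hφ : IsLiftChart X B (c i 1) false (φ (i + 1)) := Or.inr (by
      rw [hc1 i]; exact hd (i + 1))
    filter_upwards [hs, ((hc i).continuousOn 1 (by simp)).eventually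
      (hχ.eventually_strand_imp hφ)] with s a1 a2 using a2 a1
  · obtain ⟨χ, hχ, hs⟩ := hcu (i + 1)
    have hφ : IsLiftChart X B (c (i + 1) 0) true (φ (i + 1)) := Or.inr (by
      rw [hc0 (i + 1)]; exact hd (i + 1))
    filter_upwards [hs, ((hc (i + 1)).continuousOn 0 (by simp)).eventually
      (hχ.eventually_strand_imp hφ)] with s a1 a2 using a2 a1

theorem IsCurveColoring.eq_of_isSmoothSegment [IsManifold (𝓡 3) ∞ M]
    (hB : IsBranchedSurface X B) {P : Type*} {K : M × Bool → P} (hK : IsCurveColoring X B K)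
    {c : ℝ → M} (hc : IsSmoothSegment X B c) {σ τ : Bool} (hσ : Follows X B c 0 σ)
    (hτ : Follows X B c 1 τ) : K (c 0, σ) = K (c 1, τ) := by
  have hex : ∀ t : ℝ, ∃ ρ, t ∈ Icc (0 : ℝ) 1 → Follows X B c t ρ := by
    intro t
    by_cases ht : t ∈ Icc (0 : ℝ) 1
    · obtain ⟨ρ, hρ⟩ := hc.exists_follows ht
      exact ⟨ρ, fun _ => hρ⟩
    · exact ⟨false, fun h => absurd h ht⟩
  choose ρ hρ using hex
  have hloc : ∀ t ∈ Icc (0 : ℝ) 1, ∀ᶠ s in 𝓝[Icc 0 1] t, K (c t, ρ t) = K (c s, ρ s) := by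
    intro t ht
    obtain ⟨φ, hφ, h1⟩ := hρ t ht
    filter_upwards [h1, hc.eventually_ne ht, self_mem_nhdsWithin,
      (hρ t ht).eventually_isBranchModel hB hc ht,
      (hc.continuousOn t ht).eventually (hK _ _ φ hφ)] with s a1 a2 a3 a4 a5
    by_cases hst : s = t
    · rw [hst]
    · obtain ⟨ψ, hψ⟩ := a4 hst
      have hs : ρ s = false := by
        obtain ⟨χ, hχ, -⟩ := hρ s a3
        cases he : ρ s
        · rfl
        · rw [he] at hχ
          exact absurd hχ hψ.not_isLiftChart_true
      rw [hs]
      exact (a5 a1 (a2 hst)).symm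
  have h01 := isPreconnected_Icc.induction₂ (fun s t => K (c s, ρ s) = K (c t, ρ t)) hloc
    (fun _ _ _ _ _ _ h h' => h.trans h') (fun _ _ _ _ h => h.symm)
    (left_mem_Icc.2 (zero_le_one' ℝ)) (right_mem_Icc.2 (zero_le_one' ℝ))
  rw [hc.follows_unique (by simp) hσ (hρ 0 (by simp)),
    hc.follows_unique (by simp) hτ (hρ 1 (by simp))]
  exact h01

theorem transGen_of_cycle {P : Type*} {r : P → P → Prop} {n : ℕ} {k : Fin (n + 1) → P}
    (h : ∀ i, r (k i) (k (i + 1))) : Relation.TransGen r (k 0) (k 0) := by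
  have h1 : ∀ i : Fin (n + 1), Relation.TransGen r (k 0) (k (i + 1)) := by
    intro i
    induction i using Fin.induction with
    | zero => exact Relation.TransGen.single (h 0)
    | succ i ih =>
      rw [Fin.coeSucc_eq_succ] at ih
      exact ih.tail (h _)
  simpa using h1 (Fin.last n)

/-- A colouring of the smooth curves that increases, for an acyclic relation, from the lower to
the upper curve at every double point excludes twisted curves. -/
theorem IsCurveColoring.not_hasTwistedCurve [IsManifold (𝓡 3) ∞ M]
    (hB : IsBranchedSurface X B) {P : Type*} {K : M × Bool → P} (hK : IsCurveColoring X B K)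
    {r : P → P → Prop} (hr : ∀ x, ¬ Relation.TransGen r x x)
    (hKr : ∀ p φ, IsDoubleModel X B p φ → r (K (p, false)) (K (p, true))) :
    ¬ HasTwistedCurve X B := by
  rintro ⟨n, c, ⟨hc, hcor⟩ | ⟨hc, hcor⟩⟩
  · choose he φ hφ h1 h2 using hcor
    have f1 : ∀ i, Follows X B (c i) 1 false := fun i => ⟨φ i, Or.inr (hφ i), h1 i⟩
    have f0 : ∀ i, Follows X B (c (i + 1)) 0 true := fun i =>
      ⟨φ i, Or.inr (he i ▸ hφ i), h2 i⟩
    refine hr _ (transGen_of_cycle (k := fun i => K (c i 1, false)) fun i => ?_)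
    have h3 := hK.eq_of_isSmoothSegment hB (hc (i + 1)) (f0 i) (f1 (i + 1))
    have h4 := hKr _ _ (hφ i)
    rw [← h3, ← he i]
    exact h4
  · choose he φ hφ h1 h2 using hcor
    have f1 : ∀ i, Follows X B (c i) 1 true := fun i => ⟨φ i, Or.inr (hφ i), h1 i⟩
    have f0 : ∀ i, Follows X B (c (i + 1)) 0 false := fun i =>
      ⟨φ i, Or.inr (he i ▸ hφ i), h2 i⟩
    refine hr _ (Relation.transGen_swap.1
      (transGen_of_cycle (k := fun i => K (c i 1, true)) fun i => ?_))
    have h3 := hK.eq_of_isSmoothSegment hB (hc (i + 1)) (f0 i) (f1 (i + 1))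
    have h4 := hKr _ _ (hφ i)
    rw [← h3, ← he i]
    exact h4

end Curves

/-! ### Modifications inside a box -/

section Boxes

variable {M : Type*} [TopologicalSpace M] [ChartedSpace E3 M]
  {X : ∀ p : M, TangentSpace (𝓡 3) p} {B B' : Set M} {Φ : OpenPartialHomeomorph M E3}

/-- The closed cube of half-side 2 in a chart. -/
def cube (Φ : OpenPartialHomeomorph M E3) : Set M :=
  {q | q ∈ Φ.source ∧ ∀ i, |Φ q i| ≤ 2}

omit [ChartedSpace E3 M] in
theorem isClosed_cube [T2Space M] (hΦ : Φ.target = {u | ∀ i, |u i| < 3}) :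
    IsClosed (cube Φ) := by
  have h1 : IsCompact (WithLp.toLp 2 '' (univ.pi fun _ : Fin 3 => Icc (-2 : ℝ) 2) : Set E3) :=
    (isCompact_univ_pi fun _ => isCompact_Icc).image (PiLp.continuous_toLp 2 _)
  have h2 : (WithLp.toLp 2 '' (univ.pi fun _ : Fin 3 => Icc (-2 : ℝ) 2) : Set E3) ⊆ Φ.target := by
    rintro _ ⟨u, hu, rfl⟩
    rw [hΦ]
    intro i
    exact (abs_le.2 (hu i trivial)).trans_lt (by norm_num)
  have h3 : cube Φ =
      Φ.symm '' (WithLp.toLp 2 '' (univ.pi fun _ : Fin 3 => Icc (-2 : ℝ) 2) : Set E3) := by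
    ext q
    constructor
    · rintro ⟨h4, h5⟩
      exact ⟨Φ q, ⟨_, fun i _ => abs_le.1 (h5 i), rfl⟩, Φ.left_inv h4⟩
    · rintro ⟨v, ⟨u, hu, rfl⟩, rfl⟩
      have hv := h2 ⟨u, hu, rfl⟩
      refine ⟨Φ.map_target hv, fun i => ?_⟩
      rw [Φ.right_inv hv]
      exact abs_le.2 (hu i trivial)
  rw [h3]
  exact (h1.image_of_continuousOn (Φ.continuousOn_symm.mono h2)).isClosed

theorem IsBranchModel.congr {p : M} {φ : OpenPartialHomeomorph M E3}
    (h : IsBranchModel X B p φ) (he : ∀ᶠ q in 𝓝 p, q ∈ B ↔ q ∈ B') : IsBranchModel X B' p φ := by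
  obtain ⟨h1, b, h2, h3, h4⟩ := h
  refine ⟨h1, b, h2, h3, ?_⟩
  filter_upwards [h4, he] with q a1 a2
  rw [← a2, a1]

theorem IsDoubleModel.congr {p : M} {φ : OpenPartialHomeomorph M E3}
    (h : IsDoubleModel X B p φ) (he : ∀ᶠ q in 𝓝 p, q ∈ B ↔ q ∈ B') : IsDoubleModel X B' p φ := by
  obtain ⟨h1, a, b, h2, h2', h3, h3', h4⟩ := h
  refine ⟨h1, a, b, h2, h2', h3, h3', ?_⟩
  filter_upwards [h4, he] with q a1 a2
  rw [← a2, a1]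

theorem IsLiftChart.congr {p : M} {σ : Bool} {φ : OpenPartialHomeomorph M E3}
    (h : IsLiftChart X B p σ φ) (he : ∀ᶠ q in 𝓝 p, q ∈ B ↔ q ∈ B') : IsLiftChart X B' p σ φ :=
  h.imp (fun h => ⟨h.1, h.2.congr he⟩) fun h => h.congr he

theorem IsSimpleAt.congr {p : M} (h : IsSimpleAt X B p) (he : ∀ᶠ q in 𝓝 p, q ∈ B ↔ q ∈ B') :
    IsSimpleAt X B' p := by
  obtain ⟨φ, h1, h2, V, hV, h3⟩ := h
  refine ⟨φ, h1, h2, _, Filter.inter_mem hV he, ?_⟩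
  rintro q ⟨⟨hq, hqe⟩, hqB⟩ q' ⟨⟨hq', hqe'⟩, hqB'⟩
  have e1 : q ∈ B ↔ q ∈ B' := hqe
  have e2 : q' ∈ B ↔ q' ∈ B' := hqe'
  exact h3 q ⟨hq, e1.2 hqB⟩ q' ⟨hq', e2.2 hqB'⟩

/-- The twisted curves of a modification `B'` of `B` inside a box can be controlled if the
two curves `α = 0` and `β = 0` of the new singular locus continue smooth curves `cα` and `cβ` of
`B` outside the box: then `B'` is coloured by the smooth curves of `B`, and the only new
relation, at the new double points `α = β = 0`, is that `cβ` is over `cα`. -/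
theorem IsGapChart.not_hasTwistedCurve [T2Space M] [IsManifold (𝓡 3) ∞ M]
    (hB : IsBranchedSurface X B) (hB' : IsBranchedSurface X B')
    (hΦ : Φ.target = {u | ∀ i, |u i| < 3}) (hag : AgreeOutside Φ B B')
    {f₀ f₁ f₂ α β : ℝ × ℝ → ℝ} (hg : IsGapChart X B' Φ Φ.source f₀ f₁ f₂ α β)
    {cα cβ : Set (M × Bool)} {r : Set (M × Bool) → Set (M × Bool) → Prop}
    (hr : ∀ x, ¬ Relation.TransGen r x x) (hover : ∀ x y, IsOver X B x y → r x y)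
    (hcol : ∀ q ∈ Φ.source, q ∉ cube Φ → q ∈ B → ¬ IsSimpleAt X B q →
      (α (base Φ q) = 0 → curveOf X B (q, false) = cα) ∧
      (α (base Φ q) ≠ 0 → curveOf X B (q, false) = cβ))
    (hcross : ∀ u, α u = 0 → β u = 0 → r cα cβ ∧
      (∃ᶠ v in 𝓝 u, 0 < α v ∧ 0 < β v) ∧
      (∀ᶠ v in 𝓝 u, α v = 0 → β v = 0 → v = u) ∧
      (∃ L : ℝ × ℝ →L[ℝ] ℝ, HasFDerivAt α L u ∧ L ≠ 0) ∧
      ∃ L : ℝ × ℝ →L[ℝ] ℝ, HasFDerivAt β L u ∧ L ≠ 0) :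
    ¬ HasTwistedCurve X B' := by
  classical
  have hcl := isClosed_cube hΦ
  have hagree : ∀ p ∉ cube Φ, ∀ᶠ q in 𝓝 p, q ∈ B' ↔ q ∈ B := fun p hp =>
    Filter.mem_of_superset (hcl.isOpen_compl.mem_nhds hp) fun q hq => hag q hq
  set K : M × Bool → Set (M × Bool) := fun v =>
    if v.1 ∈ cube Φ then (if v.2 = false ∧ α (base Φ v.1) = 0 then cα else cβ)
    else curveOf X B v with hK
  have hKin : ∀ p ∈ cube Φ, ∀ σ, K (p, σ) =
      if σ = false ∧ α (base Φ p) = 0 then cα else cβ := fun p hp σ => if_pos hp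
  have hKout : ∀ p ∉ cube Φ, ∀ σ, K (p, σ) = curveOf X B (p, σ) := fun p hp σ => if_neg hp
  have hKsing : ∀ q ∈ Φ.source, q ∈ B' → ¬ IsSimpleAt X B' q →
      K (q, false) = if α (base Φ q) = 0 then cα else cβ := by
    intro q hq hqB hqs
    by_cases hqc : q ∈ cube Φ
    · rw [hKin q hqc]
      simp
    · rw [hKout q hqc]
      have he := hagree q hqc
      obtain ⟨h1, h2⟩ := hcol q hq hqc (he.self_of_nhds.1 hqB)
        fun hs => hqs (hs.congr (he.mono fun _ h => h.symm))
      split_ifs with hα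
      · exact h1 hα
      · exact h2 hα
  have hKcol : IsCurveColoring X B' K := by
    intro p σ φ hφ
    by_cases hp : p ∈ cube Φ
    · have hps := hp.1
      obtain ⟨hmid, hαβ⟩ := hg.mid_of_not_isSimpleAt hps hφ.mem hφ.not_isSimpleAt
      rw [hKin p hp]
      have hnear : ∀ᶠ q in 𝓝 p, q ∈ strand φ σ →
          (K (q, false) = if α (base Φ q) = 0 then cα else cβ) ∧
          Φ q 2 = f₁ (base Φ q) ∧ (α (base Φ q) = 0 ∨ β (base Φ q) = 0) := by
        filter_upwards [hφ.eventually_not_isSimpleAt, Φ.open_source.mem_nhds hps] with q h1 h2 hq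
        exact ⟨hKsing q h2 (h1 hq).1 (h1 hq).2, hg.mid_of_not_isSimpleAt h2 (h1 hq).1 (h1 hq).2⟩
      by_cases hα : α (base Φ p) = 0
      · by_cases hβ : β (base Φ p) = 0
        · obtain ⟨-, hfr, hiso, ⟨Lα, hLα, hLα0⟩, ⟨Lβ, hLβ, hLβ0⟩⟩ := hcross _ hα hβ
          have hd : IsDoubleModel X B' p φ := by
            rcases hφ with ⟨-, h⟩ | h
            · exact absurd h.isAtMostDoubleAt (hg.not_isAtMostDoubleAt hps hmid hα hβ hfr)
            · exact h
          filter_upwards [hnear, hd.eventually_strand hg hps hα hβ hLα hLβ hLα0 hLβ0,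
            (continuousAt_base hps).eventually hiso, Φ.open_source.mem_nhds hps]
            with q h1 h2 h3 h4 hq hqp
          obtain ⟨h5, h6, -⟩ := h1 hq
          rw [h5]
          cases σ
          · rw [if_pos (h2.1 hq), if_pos ⟨rfl, hα⟩]
          · rw [if_neg, if_neg (by simp)]
            intro hqα
            have hb := h3 hqα (h2.2 hq)
            exact hqp (eq_of_base_eq h4 hps hb (by rw [h6, hmid, hb]))
        · have hσ : σ = false := by
            rcases hφ with h | h
            · exact h.1
            · exact absurd (hg.isAtMostDoubleAt hps h.mem (Or.inr hβ)) h.not_isAtMostDoubleAt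
          filter_upwards [hnear, (hg.continuousAt_comp hps hg.contβ).eventually_ne hβ]
            with q h1 h2 hq _
          rw [(h1 hq).1, if_pos ((h1 hq).2.2.resolve_right h2), if_pos ⟨hσ, hα⟩]
      · filter_upwards [hnear, (hg.continuousAt_comp hps hg.contα).eventually_ne hα]
          with q h1 h2 hq _
        rw [(h1 hq).1, if_neg h2, if_neg fun h => hα h.2]
    · have h1 := isCurveColoring_curveOf hB p σ φ (hφ.congr (hagree p hp))
      rw [hKout p hp]
      filter_upwards [h1, hcl.isOpen_compl.mem_nhds hp] with q h2 h3 hq hqp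
      rw [hKout q h3]
      exact h2 hq hqp
  refine hKcol.not_hasTwistedCurve hB' hr fun p φ hd => ?_
  by_cases hp : p ∈ cube Φ
  · have h0 : α (base Φ p) = 0 ∧ β (base Φ p) = 0 := by
      by_contra hne
      exact hd.not_isAtMostDoubleAt (hg.isAtMostDoubleAt hp.1 hd.mem (by tauto))
    rw [hKin p hp, hKin p hp, if_pos ⟨rfl, h0.1⟩, if_neg (by simp)]
    exact (hcross _ h0.1 h0.2).1
  · rw [hKout p hp, hKout p hp]
    exact hover _ _ ⟨p, φ, hd.congr (hagree p hp), rfl, rfl⟩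

namespace IsSplittingBox

variable {γ : ℝ → M}

theorem abs_lt (h : IsSplittingBox X B γ Φ) {q : M} (hq : q ∈ Φ.source) (i : Fin 3) :
    |Φ q i| < 3 := by
  have := Φ.map_source hq
  rw [h.target_eq] at this
  exact this i

theorem exists_gapChart (h : IsSplittingBox X B γ Φ) : ∃ b : ℝ × ℝ → ℝ,
    IsGapChart X B Φ Φ.source (fun _ => 0) b b (fun u => u.2 ^ 2 - 1) (fun _ => -1) := by
  obtain ⟨b, hb, hb', hm⟩ := h.sheets
  have hlt : ∀ q ∈ Φ.source, 0 ≤ b (base Φ q) ∧ (0 < b (base Φ q) ↔ 1 < |Φ q 1|) :=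
    fun q hq => hb' _ _ (h.abs_lt hq 0) (h.abs_lt hq 1)
  refine ⟨b, ⟨h.flowBox, Φ.open_source, subset_rfl, continuous_const, hb.continuous,
    hb.continuous, by fun_prop, continuous_const, fun q hq => (hlt q hq).1, fun _ _ => le_rfl,
    fun q hq => ?_, fun q hq => ?_, fun q hq => ?_⟩⟩
  · rw [(hlt q hq).2, ← one_lt_sq_iff_one_lt_abs, ← sub_pos]
    rfl
  · norm_num
  · rw [hm q hq]
    simp only [base, or_self]

/-- In a splitting box the singular locus is contained in the lines `y = ±1`, `z = 0`. -/
theorem eq_of_not_isSimpleAt (h : IsSplittingBox X B γ Φ) {q : M} (hq : q ∈ Φ.source)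
    (hqB : q ∈ B) (hs : ¬ IsSimpleAt X B q) : (Φ q 1 = -1 ∨ Φ q 1 = 1) ∧ Φ q 2 = 0 := by
  obtain ⟨b, hg⟩ := h.exists_gapChart
  obtain ⟨h1, h2 | h2⟩ := hg.mid_of_not_isSimpleAt hq hqB hs
  · have h3 : Φ q 1 ^ 2 = 1 ^ 2 := by
      rw [one_pow]
      exact sub_eq_zero.1 h2
    refine ⟨(sq_eq_sq_iff_eq_or_eq_neg.1 h3).symm, ?_⟩
    rw [h1]
    exact le_antisymm (not_lt.1 fun hlt => ((hg.lt₀₁ q hq).1 hlt).ne' h2) (hg.le₀₁ q hq)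
  · norm_num at h2

variable [IsManifold (𝓡 3) ∞ M]

theorem exists_isBranchModel (hB : IsBranchedSurface X B) (h : IsSplittingBox X B γ Φ) {q : M}
    (hq : q ∈ Φ.source) (h1 : Φ q 1 ^ 2 = 1) (h2 : Φ q 2 = 0) : ∃ ψ, IsBranchModel X B q ψ := by
  obtain ⟨b, hg⟩ := h.exists_gapChart
  have hqB : q ∈ B := (hg.mem_iff q hq).2 (Or.inl h2)
  have hα : (base Φ q).2 ^ 2 - 1 = 0 := sub_eq_zero.2 h1
  have hb : b (base Φ q) = 0 :=
    le_antisymm (not_lt.1 fun hlt => ((hg.lt₀₁ q hq).1 hlt).ne' hα) (hg.le₀₁ q hq)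
  refine hB.exists_isBranchModel hqB (hg.not_isSimpleAt_of_α hq (h2.trans hb.symm) hα ?_)
    (hg.isAtMostDoubleAt hq hqB (Or.inr (by norm_num)))
  -- Moving away from `y = 0` makes `y ^ 2 - 1` positive.
  have hc : Continuous fun t : ℝ => ((base Φ q).1, (base Φ q).2 * t) := by fun_prop
  have ht : Tendsto (fun t : ℝ => ((base Φ q).1, (base Φ q).2 * t)) (𝓝[>] 1) (𝓝 (base Φ q)) := by
    have := (hc.tendsto 1).mono_left (nhdsWithin_le_nhds (s := Ioi (1 : ℝ)))
    simpa using this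
  have hev : ∀ᶠ t : ℝ in 𝓝[>] 1, 0 < ((base Φ q).2 * t) ^ 2 - 1 := by
    filter_upwards [self_mem_nhdsWithin] with t ht
    have ht' : 1 < t := ht
    rw [mul_pow, sub_eq_zero.1 hα]
    nlinarith
  exact ht.frequently hev.frequently

/-- Each of the lines `y = ±1`, `z = 0` of a splitting box is in one smooth curve. -/
theorem curveOf_eq [T2Space M] (hB : IsBranchedSurface X B) (h : IsSplittingBox X B γ Φ)
    {q q' : M} (hq : q ∈ Φ.source) (hq' : q' ∈ Φ.source) (h1 : Φ q 1 ^ 2 = 1)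
    (h2 : Φ q 2 = 0) (h1' : Φ q' 1 = Φ q 1) (h2' : Φ q' 2 = 0) :
    curveOf X B (q, false) = curveOf X B (q', false) := by
  set g : ℝ → E3 := fun x => !₂[x, Φ q 1, 0] with hgdef
  have hgc : Continuous g := by
    apply (PiLp.continuous_toLp 2 _).comp
    apply continuous_pi
    intro i
    fin_cases i
    · exact continuous_id
    · exact continuous_const
    · exact continuous_const
  have hgt : ∀ x ∈ Ioo (-3 : ℝ) 3, g x ∈ Φ.target := by
    intro x hx
    rw [h.target_eq]
    intro i
    fin_cases i
    · exact _root_.abs_lt.2 hx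
    · exact h.abs_lt hq 1
    · simp [hgdef]
  have hs : ∀ x ∈ Ioo (-3 : ℝ) 3, Φ.symm (g x) ∈ Φ.source := fun x hx => Φ.map_target (hgt x hx)
  have hbr : ∀ x ∈ Ioo (-3 : ℝ) 3, ∃ ψ, IsBranchModel X B (Φ.symm (g x)) ψ := by
    intro x hx
    apply h.exists_isBranchModel hB (hs x hx)
    · rw [Φ.right_inv (hgt x hx)]
      simpa [hgdef] using h1
    · rw [Φ.right_inv (hgt x hx)]
      simp [hgdef]
  have hloc : ∀ x ∈ Ioo (-3 : ℝ) 3, ∀ᶠ y in 𝓝[Ioo (-3) 3] x,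
      curveOf X B (Φ.symm (g x), false) = curveOf X B (Φ.symm (g y), false) := by
    intro x hx
    obtain ⟨ψ, hψ⟩ := hbr x hx
    have hψ' : IsLiftChart X B (Φ.symm (g x)) false ψ := Or.inl ⟨rfl, hψ⟩
    have hc : ContinuousWithinAt (fun y => Φ.symm (g y)) (Ioo (-3) 3) x :=
      (ContinuousAt.comp (f := g) (Φ.continuousAt_symm (hgt x hx))
        hgc.continuousAt).continuousWithinAt
    filter_upwards [self_mem_nhdsWithin, hc.eventually (hψ'.eventually_mem_strand.and
      (isCurveColoring_curveOf hB _ _ ψ hψ'))] with y hy hev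
    obtain ⟨χ, hχ⟩ := hbr y hy
    have hχ' : IsLiftChart X B (Φ.symm (g y)) false χ := Or.inl ⟨rfl, hχ⟩
    by_cases he : Φ.symm (g y) = Φ.symm (g x)
    · rw [he]
    · exact (hev.2 ((hev.1 hχ'.mem hχ'.not_isSimpleAt).resolve_right
        fun hu => hu.1.not_isBranchModel hψ) he).symm
  have hpt : ∀ {s : M}, s ∈ Φ.source → Φ s 1 = Φ q 1 → Φ s 2 = 0 → Φ.symm (g (Φ s 0)) = s := by
    intro s hs hs1 hs2
    have : g (Φ s 0) = Φ s := by
      ext i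
      fin_cases i
      · rfl
      · exact hs1.symm
      · exact hs2.symm
    rw [this, Φ.left_inv hs]
  have := isPreconnected_Ioo.induction₂
    (fun x y => curveOf X B (Φ.symm (g x), false) = curveOf X B (Φ.symm (g y), false)) hloc
    (fun _ _ _ _ _ _ h h' => h.trans h') (fun _ _ _ _ h => h.symm)
    (_root_.abs_lt.1 (h.abs_lt hq 0)) (_root_.abs_lt.1 (h.abs_lt hq' 0))
  rwa [hpt hq rfl h2, hpt hq' h1' h2'] at this

theorem curveOf_eq_start [T2Space M] (hB : IsBranchedSurface X B)
    (h : IsSplittingBox X B γ Φ) {q : M} (hq : q ∈ Φ.source) (h1 : Φ q 1 = -1)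
    (h2 : Φ q 2 = 0) : curveOf X B (q, false) = curveOf X B (γ 0, false) := by
  obtain ⟨a1, -, a2, a3⟩ := h.arc 0 (by simp)
  exact h.curveOf_eq hB hq a1 (by rw [h1]; norm_num) h2 (by rw [a2, h1]; norm_num) a3

theorem curveOf_eq_finish [T2Space M] (hB : IsBranchedSurface X B)
    (h : IsSplittingBox X B γ Φ) {q : M} (hq : q ∈ Φ.source) (h1 : Φ q 1 = 1)
    (h2 : Φ q 2 = 0) : curveOf X B (q, false) = curveOf X B (γ 1, false) := by
  obtain ⟨a1, -, a2, a3⟩ := h.arc 1 (by simp)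
  exact h.curveOf_eq hB hq a1 (by rw [h1]; norm_num) h2 (by rw [a2, h1]; norm_num) a3

omit [IsManifold (𝓡 3) ∞ M] in
/-- Outside the cube, the singular locus of `B` in a splitting box is over `|x| > 2`. -/
theorem two_lt_abs (h : IsSplittingBox X B γ Φ) {q : M} (hq : q ∈ Φ.source) (hqc : q ∉ cube Φ)
    (hqB : q ∈ B) (hs : ¬ IsSimpleAt X B q) : 2 < |Φ q 0| := by
  obtain ⟨h1, h2⟩ := h.eq_of_not_isSimpleAt hq hqB hs
  by_contra! hle
  refine hqc ⟨hq, fun i => ?_⟩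
  fin_cases i
  · exact hle
  · rcases h1 with h1 | h1 <;> simp [h1]
  · simp [h2]

end IsSplittingBox

theorem IsStackOfSheets.isGapChart₃ {γ : ℝ → M} (h : IsSplittingBox X B γ Φ)
    {f : Fin 3 → ℝ × ℝ → ℝ} (hf : IsStackOfSheets Φ B' f) {α β : ℝ × ℝ → ℝ} (hα : Continuous α)
    (hβ : Continuous β) (hαβ : ∀ x y : ℝ, |x| < 3 → |y| < 3 →
      (f 0 (x, y) < f 1 (x, y) ↔ 0 < α (x, y)) ∧ (f 1 (x, y) < f 2 (x, y) ↔ 0 < β (x, y))) :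
    IsGapChart X B' Φ Φ.source (f 0) (f 1) (f 2) α β where
  flowBox := h.flowBox
  isOpen := Φ.open_source
  subset := subset_rfl
  cont₀ := (hf.smooth 0).continuous
  cont₁ := (hf.smooth 1).continuous
  cont₂ := (hf.smooth 2).continuous
  contα := hα
  contβ := hβ
  le₀₁ q hq := hf.ordered 0 1 (by decide) _ _ (h.abs_lt hq 0) (h.abs_lt hq 1)
  le₁₂ q hq := hf.ordered 1 2 (by decide) _ _ (h.abs_lt hq 0) (h.abs_lt hq 1)
  lt₀₁ q hq := (hαβ _ _ (h.abs_lt hq 0) (h.abs_lt hq 1)).1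
  lt₁₂ q hq := (hαβ _ _ (h.abs_lt hq 0) (h.abs_lt hq 1)).2
  mem_iff q hq := by
    rw [hf.mem_iff q hq, Fin.exists_fin_succ, Fin.exists_fin_two]
    rfl

theorem IsStackOfSheets.isGapChart₂ {γ : ℝ → M} (h : IsSplittingBox X B γ Φ)
    {f : Fin 2 → ℝ × ℝ → ℝ} (hf : IsStackOfSheets Φ B' f) {α : ℝ × ℝ → ℝ} (hα : Continuous α)
    (hαf : ∀ x y : ℝ, |x| < 3 → |y| < 3 → (f 0 (x, y) < f 1 (x, y) ↔ 0 < α (x, y))) :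
    IsGapChart X B' Φ Φ.source (f 0) (f 1) (f 1) α (fun _ => -1) where
  flowBox := h.flowBox
  isOpen := Φ.open_source
  subset := subset_rfl
  cont₀ := (hf.smooth 0).continuous
  cont₁ := (hf.smooth 1).continuous
  cont₂ := (hf.smooth 1).continuous
  contα := hα
  contβ := continuous_const
  le₀₁ q hq := hf.ordered 0 1 (by decide) _ _ (h.abs_lt hq 0) (h.abs_lt hq 1)
  le₁₂ q hq := le_rfl
  lt₀₁ q hq := hαf _ _ (h.abs_lt hq 0) (h.abs_lt hq 1)
  lt₁₂ q hq := by norm_num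
  mem_iff q hq := by
    rw [hf.mem_iff q hq, Fin.exists_fin_two, or_self]
    rfl

end Boxes

/-! ### The three splittings -/

section CrossingPair

variable {s e : ℝ → ℝ}

theorem IsCrossingPair.frequently (h : IsCrossingPair s e) {u : ℝ × ℝ} (h1 : u.2 - e u.1 = 0)
    (h2 : s u.1 - u.2 = 0) : ∃ᶠ v in 𝓝 u, 0 < v.2 - e v.1 ∧ 0 < s v.1 - v.2 := by
  obtain ⟨r, hr0, -, hr⟩ := h.cross
  have hur : |u.1| = r := by
    rcases lt_trichotomy |u.1| r with hlt | heq | hgt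
    · linarith [(hr u.1).1 hlt]
    · exact heq
    · linarith [(hr u.1).2.2 hgt]
  -- Inside the crossing points, the midpoints between the two curves.
  have hs := h.smooth_s.continuous
  have he := h.smooth_e.continuous
  have hc : Continuous fun t : ℝ => (t * u.1, (s (t * u.1) + e (t * u.1)) / 2) := by fun_prop
  have ht : Tendsto (fun t : ℝ => (t * u.1, (s (t * u.1) + e (t * u.1)) / 2)) (𝓝[<] 1) (𝓝 u) := by
    have := (hc.tendsto 1).mono_left (nhdsWithin_le_nhds (s := Iio (1 : ℝ)))
    rwa [one_mul, show (u.1, (s u.1 + e u.1) / 2) = u from Prod.ext rfl (by linarith)] at this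
  have hev : ∀ᶠ t : ℝ in 𝓝[<] 1, 0 < (s (t * u.1) + e (t * u.1)) / 2 - e (t * u.1) ∧
      0 < s (t * u.1) - (s (t * u.1) + e (t * u.1)) / 2 := by
    filter_upwards [Ioo_mem_nhdsLT (zero_lt_one' ℝ)] with t ht
    have := (hr (t * u.1)).1 (by
      rw [abs_mul, hur, abs_of_pos ht.1]
      nlinarith [ht.2])
    constructor <;> linarith
  exact ht.frequently hev.frequently

theorem IsCrossingPair.eventually_eq (h : IsCrossingPair s e) {u : ℝ × ℝ}
    (h1 : u.2 - e u.1 = 0) (h2 : s u.1 - u.2 = 0) :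
    ∀ᶠ v in 𝓝 u, v.2 - e v.1 = 0 → s v.1 - v.2 = 0 → v = u := by
  obtain ⟨r, hr0, -, hr⟩ := h.cross
  have hur : ∀ v : ℝ × ℝ, v.2 - e v.1 = 0 → s v.1 - v.2 = 0 → |v.1| = r := by
    intro v h1 h2
    rcases lt_trichotomy |v.1| r with hlt | heq | hgt
    · linarith [(hr v.1).1 hlt]
    · exact heq
    · linarith [(hr v.1).2.2 hgt]
  have hu := hur u h1 h2
  have hu0 : 0 < u.1 * u.1 := by
    apply mul_self_pos.2
    intro h0
    rw [h0, abs_zero] at hu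
    exact hr0.ne hu
  have hpos : ∀ᶠ v : ℝ × ℝ in 𝓝 u, 0 < v.1 * u.1 :=
    continuousAt_const.eventually_lt (f := fun _ : ℝ × ℝ => (0 : ℝ))
      (g := fun v : ℝ × ℝ => v.1 * u.1) (by fun_prop) hu0
  filter_upwards [hpos] with v hv h3 h4
  have h5 : v.1 = u.1 := by
    rcases abs_eq_abs.1 ((hur v h3 h4).trans hu.symm) with h | h
    · exact h
    · rw [h] at hv
      linarith
  refine Prod.ext h5 ?_
  rw [h5] at h3
  linarith

theorem exists_hasFDerivAt_sub {k : ℝ → ℝ} (hk : ContDiff ℝ ∞ k) (u : ℝ × ℝ) :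
    (∃ L : ℝ × ℝ →L[ℝ] ℝ, HasFDerivAt (fun v : ℝ × ℝ => v.2 - k v.1) L u ∧ L ≠ 0) ∧
      ∃ L : ℝ × ℝ →L[ℝ] ℝ, HasFDerivAt (fun v : ℝ × ℝ => k v.1 - v.2) L u ∧ L ≠ 0 := by
  have h1 : HasFDerivAt (fun v : ℝ × ℝ => k v.1) (deriv k u.1 • ContinuousLinearMap.fst ℝ ℝ ℝ)
      u :=
    (hk.differentiable (by simp) u.1).hasDerivAt.comp_hasFDerivAt u hasFDerivAt_fst
  refine ⟨⟨_, hasFDerivAt_snd.sub h1, fun h => ?_⟩, ⟨_, h1.sub hasFDerivAt_snd, fun h => ?_⟩⟩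
  · simpa using DFunLike.congr_fun h ((0 : ℝ), (1 : ℝ))
  · simpa using DFunLike.congr_fun h ((0 : ℝ), (1 : ℝ))

end CrossingPair

section Splittings

variable {M : Type*} [TopologicalSpace M] [ChartedSpace E3 M] [T2Space M]
  [IsManifold (𝓡 3) ∞ M] {X : ∀ p : M, TangentSpace (𝓡 3) p} {B B' : Set M} {γ : ℝ → M}

/-- An acyclic relation stays acyclic when the pair `(a, b)` is added, if `a` cannot be reached
from `b`. -/
theorem not_transGen_or {P : Type*} {r : P → P → Prop} (hr : ∀ x, ¬ Relation.TransGen r x x)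
    {a b : P} (hab : ¬ Relation.ReflTransGen r b a) (x : P) :
    ¬ Relation.TransGen (fun x y => r x y ∨ x = a ∧ y = b) x x := by
  have key : ∀ x y, Relation.TransGen (fun x y => r x y ∨ x = a ∧ y = b) x y →
      Relation.TransGen r x y ∨ Relation.ReflTransGen r x a ∧ Relation.ReflTransGen r b y := by
    intro x y h
    induction h with
    | single h =>
      rcases h with h | ⟨rfl, rfl⟩
      · exact Or.inl (Relation.TransGen.single h)
      · exact Or.inr ⟨Relation.ReflTransGen.refl, Relation.ReflTransGen.refl⟩
    | tail _ h ih =>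
      rcases h with h | ⟨rfl, rfl⟩
      · exact ih.imp (fun ih => ih.tail h) fun ih => ⟨ih.1, ih.2.tail h⟩
      · rcases ih with ih | ih
        · exact Or.inr ⟨ih.to_reflTransGen, Relation.ReflTransGen.refl⟩
        · exact absurd ih.2 hab
  intro h
  rcases key x x h with h | h
  · exact hr x h
  · exact hab (h.2.trans h.1)

theorem IsOverSplitting.not_hasTwistedCurve (hB : IsBranchedSurface X B)
    (hr : ∀ x, ¬ Relation.TransGen (IsOver X B) x x) (h : IsOverSplitting X B γ B')
    (hn : ¬ Relation.ReflTransGen (IsOver X B) (curveOf X B (γ 0, false))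
      (curveOf X B (γ 1, false))) : ¬ HasTwistedCurve X B' := by
  obtain ⟨hB', Φ, hbox, hag, s, e, hse, f, hf, hgap⟩ := h
  have hs := hse.smooth_s.continuous
  have he := hse.smooth_e.continuous
  have hg := hf.isGapChart₃ hbox (α := fun u => u.2 - e u.1) (β := fun u => s u.1 - u.2)
    (by fun_prop) (by fun_prop) fun x y hx hy => by
      rw [(hgap x y hx hy).1, (hgap x y hx hy).2, sub_pos, sub_pos]
      exact ⟨Iff.rfl, Iff.rfl⟩
  refine hg.not_hasTwistedCurve hB hB' hbox.target_eq hag (not_transGen_or hr hn)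
    (fun x y h => Or.inl h) (fun q hq hqc hqB hqs => ?_) fun u h1 h2 =>
      ⟨Or.inr ⟨rfl, rfl⟩, hse.frequently h1 h2, hse.eventually_eq h1 h2,
        (exists_hasFDerivAt_sub hse.smooth_e u).1, (exists_hasFDerivAt_sub hse.smooth_s u).2⟩
  have hx := hbox.two_lt_abs hq hqc hqB hqs
  obtain ⟨hy, hz⟩ := hbox.eq_of_not_isSimpleAt hq hqB hqs
  have he1 : e (base Φ q).1 = 1 := (hse.unchanged _ hx.le).2
  simp only [he1]
  rcases hy with hy | hy
  · have : (base Φ q).2 = -1 := hy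
    rw [this]
    exact ⟨fun h => by norm_num at h, fun _ => hbox.curveOf_eq_start hB hq hy hz⟩
  · have : (base Φ q).2 = 1 := hy
    rw [this]
    exact ⟨fun _ => hbox.curveOf_eq_finish hB hq hy hz, fun h => by norm_num at h⟩

theorem IsUnderSplitting.not_hasTwistedCurve (hB : IsBranchedSurface X B)
    (hr : ∀ x, ¬ Relation.TransGen (IsOver X B) x x) (h : IsUnderSplitting X B γ B')
    (hn : ¬ Relation.ReflTransGen (IsOver X B) (curveOf X B (γ 1, false))
      (curveOf X B (γ 0, false))) : ¬ HasTwistedCurve X B' := by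
  obtain ⟨hB', Φ, hbox, hag, s, e, hse, f, hf, hgap⟩ := h
  have hs := hse.smooth_s.continuous
  have he := hse.smooth_e.continuous
  have hg := hf.isGapChart₃ hbox (α := fun u => s u.1 - u.2) (β := fun u => u.2 - e u.1)
    (by fun_prop) (by fun_prop) fun x y hx hy => by
      rw [(hgap x y hx hy).1, (hgap x y hx hy).2, sub_pos, sub_pos]
      exact ⟨Iff.rfl, Iff.rfl⟩
  refine hg.not_hasTwistedCurve hB hB' hbox.target_eq hag (not_transGen_or hr hn)
    (fun x y h => Or.inl h) (fun q hq hqc hqB hqs => ?_) fun u h1 h2 =>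
      ⟨Or.inr ⟨rfl, rfl⟩, (hse.frequently h2 h1).mono fun _ h => h.symm,
        (hse.eventually_eq h2 h1).mono fun _ h h1 h2 => h h2 h1,
        (exists_hasFDerivAt_sub hse.smooth_s u).2, (exists_hasFDerivAt_sub hse.smooth_e u).1⟩
  have hx := hbox.two_lt_abs hq hqc hqB hqs
  obtain ⟨hy, hz⟩ := hbox.eq_of_not_isSimpleAt hq hqB hqs
  have he1 : s (base Φ q).1 = -1 := (hse.unchanged _ hx.le).1
  simp only [he1]
  rcases hy with hy | hy
  · have : (base Φ q).2 = -1 := hy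
    rw [this]
    exact ⟨fun _ => hbox.curveOf_eq_start hB hq hy hz, fun h => by norm_num at h⟩
  · have : (base Φ q).2 = 1 := hy
    rw [this]
    exact ⟨fun h => by norm_num at h, fun _ => hbox.curveOf_eq_finish hB hq hy hz⟩

/-- If both ends of the arc are on the same curve, the neutral splitting only cuts and reglues
this curve: collapsing the new curves to it gives a colouring. -/
theorem IsNeutralSplitting.not_hasTwistedCurve (hB : IsBranchedSurface X B)
    (hr : ∀ x, ¬ Relation.TransGen (IsOver X B) x x) (h : IsNeutralSplitting X B γ B')
    (heq : curveOf X B (γ 0, false) = curveOf X B (γ 1, false)) : ¬ HasTwistedCurve X B' := by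
  obtain ⟨hB', Φ, hbox, hag, g, hgp, f, hf, hgap⟩ := h
  have hgc := hgp.smooth.continuous
  have hg := hf.isGapChart₂ hbox (α := fun u => u.2 ^ 2 - g u.1) (by fun_prop)
    fun x y hx hy => by rw [hgap x y hx hy, sub_pos]
  refine hg.not_hasTwistedCurve hB hB' hbox.target_eq hag (cα := curveOf X B (γ 0, false))
    (cβ := curveOf X B (γ 0, false)) hr (fun x y h => h) (fun q hq hqc hqB hqs => ?_)
    fun u _ h2 => by norm_num at h2
  obtain ⟨hy, hz⟩ := hbox.eq_of_not_isSimpleAt hq hqB hqs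
  have hc : curveOf X B (q, false) = curveOf X B (γ 0, false) := by
    rcases hy with hy | hy
    · exact hbox.curveOf_eq_start hB hq hy hz
    · rw [heq]
      exact hbox.curveOf_eq_finish hB hq hy hz
  exact ⟨fun _ => hc, fun _ => hc⟩

end Splittings

end BranchedSurface

theorem mainTheorem3 {M : Type*} [TopologicalSpace M] [T2Space M]
    [ChartedSpace BranchedSurface.E3 M] [IsManifold (𝓡 3) ∞ M]
    (X : ∀ p : M, TangentSpace (𝓡 3) p) (B : Set M)
    (hB : BranchedSurface.IsBranchedSurface X B)
    (hnot : ¬ BranchedSurface.HasTwistedCurve X B)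
    (γ : ℝ → M) (hγ : BranchedSurface.IsFaceToFaceArc X B γ)
    (Bover Bunder Bneutral : Set M)
    (hover : BranchedSurface.IsOverSplitting X B γ Bover)
    (hunder : BranchedSurface.IsUnderSplitting X B γ Bunder)
    (hneutral : BranchedSurface.IsNeutralSplitting X B γ Bneutral) :
    ¬ BranchedSurface.HasTwistedCurve X Bover ∨
    ¬ BranchedSurface.HasTwistedCurve X Bunder ∨
    ¬ BranchedSurface.HasTwistedCurve X Bneutral := by
  have hr : ∀ x, ¬ Relation.TransGen (BranchedSurface.IsOver X B) x x :=
    fun x hx => hnot (BranchedSurface.hasTwistedCurve_of_transGen hx)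
  by_cases heq : BranchedSurface.curveOf X B (γ 0, false) =
      BranchedSurface.curveOf X B (γ 1, false)
  · exact Or.inr (Or.inr (hneutral.not_hasTwistedCurve hB hr heq))
  by_cases h01 : Relation.ReflTransGen (BranchedSurface.IsOver X B)
      (BranchedSurface.curveOf X B (γ 0, false)) (BranchedSurface.curveOf X B (γ 1, false))
  · refine Or.inr (Or.inl (hunder.not_hasTwistedCurve hB hr fun h10 => ?_))
    rcases Relation.reflTransGen_iff_eq_or_transGen.1 h01 with h | h
    · exact heq h.symm
    · exact hr _ (h.trans_left h10)
  · exact Or.inl (hover.not_hasTwistedCurve hB hr h01)
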